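/- Let $\xi\in[-1,1]$, let $g$ be a real-valued function that is analytic in a neighborhood of $[-1,1]$, let $\sigma>0$, and let $f(x)=|x-\xi|^{\sigma}g(x)$. For $n\ge 1$ let $p_n$ be the polynomial of degree at most $n$ that interpolates $f$ at the $n+1$ Chebyshev--Lobatto points $x_j=\cos(j\pi/n)$, $j=0,\dots,n$. Let $m\ge 0$ be an integer and write $\|h\|_\infty=\max_{x\in[-1,1]}|h(x)|$. (Derivatives at $\pm1$ are one-sided; under the hypotheses below $f$ is $m$ times continuously differentiable on $[-1,1]$.) 1. If $\xi\in(-1,1)$, $\sigma$ is not an even integer, and $m<\min\{\sigma,\,1+\sigma/2\}$, then, as $n\to\infty$, $$\|f^{(m)}-p_n^{(m)}\|_\infty=O\bigl(n^{\max\{m,\,2m-2\}-\sigma}\bigr).$$ 2. If $\xi=\pm1$, $\sigma$ is not an integer, and $m<\sigma$, then, as $n\to\infty$, $$\|f^{(m)}-p_n^{(m)}\|_\infty=O\bigl(n^{\max\{2m,\,m-1\}-2\sigma}\bigr).$$ The implied constants may depend on $\xi,\sigma,g,m$ but not on $n$. -/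

import Mathlib

open Filter Asymptotics

/-- The model function `f(x) = |x - ξ|^σ g(x)` with an algebraic singularity at `ξ`. -/
noncomputable def modelFun (ξ σ : ℝ) (g : ℝ → ℝ) : ℝ → ℝ :=
  fun x => |x - ξ| ^ σ * g x

/-- The polynomial of degree at most `n` which interpolates `f` at the `n + 1`
Chebyshev--Lobatto points `cos (j π / n)`, `j = 0, …, n` (for `n ≥ 1` these are distinct). -/
noncomputable def chebInterpolant (f : ℝ → ℝ) (n : ℕ) : Polynomial ℝ :=
  Lagrange.interpolate (Finset.range (n + 1)) (fun j : ℕ => Real.cos (j * Real.pi / n))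
    (fun j : ℕ => f (Real.cos (j * Real.pi / n)))

/-- The maximum norm of a function on `[-1, 1]` (meaningful for functions bounded there). -/
noncomputable def maxNorm (h : ℝ → ℝ) : ℝ :=
  sSup ((fun x => |h x|) '' Set.Icc (-1 : ℝ) 1)

/-- The error `f^(m) - p_n^(m)` on `[-1, 1]`; derivatives of `f` are taken within `[-1, 1]`,
hence are one-sided at the endpoints. -/
noncomputable def chebDiffError (f : ℝ → ℝ) (m n : ℕ) : ℝ → ℝ :=
  fun x => iteratedDerivWithin m f (Set.Icc (-1 : ℝ) 1) x
    - ((Polynomial.derivative^[m]) (chebInterpolant f n)).eval x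

/-! Let W = T_{n+1} - T_{n-1}. Since W(cos θ) = -2 sin θ sin nθ, W vanishes at every node. For a
pole t off [-1, 1] with W(t) ≠ 0 and M ≤ n + 1, the interpolation error of (x - ξ)^M / (x - t) is
exactly (t - ξ)^M W(x) / ((x - t) W(t)); see `interpErr_re_mul_div`. It remains to write f as a
superposition of such functions and to estimate this kernel.

For α > 0 not an integer, with integer part k and fractional part p, y^α is a constant times ∫
s^(p-1) y^(k+1) / (s + y) ds over s > 0 (`exists_rpow_eq_integral`). An interior singularity uses y
= (x - ξ)² and α = σ/2, with poles ξ + i√s. An endpoint singularity uses y = |x - ξ| and α = σ, with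
poles ξ(1 + s). This is where even integers, respectively integers, are excluded.

In both cases |W(t)| outgrows every power of n√s, so only s of order n⁻² matters, and the
substitution s ↦ s/n² turns powers of s into powers of n. For interior ξ and x away from ±1, each
derivative costs a factor n, giving n^(m-σ). For x near ±1, m ≥ 1 derivatives of W cost n^(2m-1)
while x - t stays bounded below, giving n^(2m-2-σ). For ξ = ±1 each derivative costs n², giving
n^(2m-2σ).

The factor g is expanded at ξ. The terms are pure powers treated as above
(`hasInterpRate_interior_power`, `hasInterpRate_endpoint_power`). The remainder is as smooth as
desired, and its Chebyshev coefficients decay fast enough for an aliasing argument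
(`hasInterpRate_of_contDiffAt`). -/

open Polynomial in
/-- `T_{n+1} - T_{n-1}`, a multiple of the node polynomial of the `n + 1`
Chebyshev--Lobatto points. -/
noncomputable def lobattoPoly (R : Type*) [CommRing R] (n : ℕ) : R[X] :=
  Chebyshev.T R (n + 1) - Chebyshev.T R (n - 1)

/-! ### Derivative bounds for Chebyshev polynomials and the node polynomial. -/

section ChebyshevBounds

open Polynomial Polynomial.Chebyshev

theorem abs_iterate_derivative_T_le_pow (n : ℤ) (k : ℕ) {x : ℝ} (hx : |x| ≤ 1) :
    |(derivative^[k] (T ℝ n)).eval x| ≤ (n : ℝ) ^ (2 * k) := by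
  refine (abs_iterate_derivative_T_real_le n k hx).trans ?_
  clear hx x
  induction k with
  | zero => simp
  | succ k ih =>
    -- The values at 1 dominate absolute values, hence are nonnegative. The recurrence at 1 then
    -- gives at most a factor n² per derivative.
    have h0 : ∀ j, 0 ≤ (derivative^[j] (T ℝ n)).eval 1 := fun j =>
      (abs_nonneg _).trans (abs_iterate_derivative_T_real_le n j (x := 1) (by simp))
    have h := iterate_derivative_T_eval_one_recurrence (R := ℝ) n k
    have h1 := h0 (k + 1)
    have hk : (0 : ℝ) ≤ k := k.cast_nonneg
    calc (derivative^[k + 1] (T ℝ n)).eval 1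
        ≤ (2 * k + 1) * (derivative^[k + 1] (T ℝ n)).eval 1 := by nlinarith [mul_nonneg hk h1]
      _ = (n ^ 2 - k ^ 2) * (derivative^[k] (T ℝ n)).eval 1 := h
      _ ≤ n ^ 2 * (derivative^[k] (T ℝ n)).eval 1 := by
          have := h0 k
          gcongr
          nlinarith
      _ ≤ n ^ 2 * (n : ℝ) ^ (2 * k) := by gcongr
      _ = (n : ℝ) ^ (2 * (k + 1)) := by ring

theorem abs_iterate_derivative_U_le_pow {n : ℕ} (hn : 1 ≤ n) (k : ℕ) {x : ℝ} (hx : |x| ≤ 1) :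
    |(derivative^[k] (U ℝ (n - 1))).eval x| ≤ (n : ℝ) ^ (2 * k + 1) := by
  have h := abs_iterate_derivative_T_le_pow n (k + 1) hx
  rw [Function.iterate_succ_apply, T_derivative_eq_U, iterate_derivative_intCast_mul] at h
  simp only [eval_mul, abs_mul, Int.cast_natCast, eval_natCast, Nat.abs_cast] at h
  have hn' : (0 : ℝ) < n := by exact_mod_cast hn
  refine le_of_mul_le_mul_left (h.trans_eq ?_) hn'
  ring

/-- Away from ±1 the differentiated Chebyshev equation can be divided by 1 - x² ≥ δ. It expresses
the derivative of order k + 2 through n² times order k and a constant times order k + 1, so a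
derivative costs n rather than n². -/
theorem exists_abs_iterate_derivative_T_le {δ : ℝ} (hδ : 0 < δ) (hδ1 : δ ≤ 1) (k : ℕ) :
    ∃ C, 0 ≤ C ∧ ∀ (n : ℤ) (x : ℝ), |x| ≤ 1 - δ →
      |(derivative^[k] (T ℝ n)).eval x| ≤ C * (|(n : ℝ)| + 1) ^ k := by
  have hden : ∀ x : ℝ, |x| ≤ 1 - δ → δ ≤ 1 - x ^ 2 := fun x hx => by
    have := abs_le.1 hx
    nlinarith
  have habs : ∀ x : ℝ, |x| ≤ 1 - δ → |x| ≤ 1 := fun x hx => by linarith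
  induction k using Nat.twoStepInduction with
  | zero =>
    exact ⟨1, zero_le_one, fun n x hx => by simpa using abs_eval_T_real_le_one n (habs x hx)⟩
  | one =>
    refine ⟨2 / δ, by positivity, fun n x hx => ?_⟩
    have h := congrArg (eval x) (one_sub_X_sq_mul_derivative_T_eq_poly_in_T (R := ℝ) (n - 1))
    simp only [sub_add_cancel, eval_mul, eval_sub, eval_one, eval_pow, eval_X,
      eval_intCast, Int.cast_sub, Int.cast_one] at h
    simp only [Function.iterate_one, pow_one]
    have h1 := abs_eval_T_real_le_one (n - 1) (habs x hx)
    have h2 := abs_eval_T_real_le_one n (habs x hx)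
    have h3 : |(T ℝ (n - 1)).eval x - x * (T ℝ n).eval x| ≤ 2 := by
      refine (abs_sub _ _).trans ?_
      rw [abs_mul]
      nlinarith [abs_nonneg x, abs_nonneg ((T ℝ n).eval x), habs x hx]
    have h4 : δ * |(derivative (T ℝ n)).eval x| ≤ |(n : ℝ)| * 2 := by
      calc δ * |(derivative (T ℝ n)).eval x| ≤ (1 - x ^ 2) * |(derivative (T ℝ n)).eval x| := by
            gcongr; exact hden x hx
        _ = |(1 - x ^ 2) * (derivative (T ℝ n)).eval x| := by
            rw [abs_mul, abs_of_nonneg (hδ.le.trans (hden x hx))]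
        _ = |(n : ℝ)| * |(T ℝ (n - 1)).eval x - x * (T ℝ n).eval x| := by rw [h, ← abs_mul]
        _ ≤ |(n : ℝ)| * 2 := by gcongr
    rw [div_mul_eq_mul_div, le_div_iff₀ hδ]
    linarith
  | more k ih1 ih2 =>
    obtain ⟨C, hC, h1⟩ := ih1
    obtain ⟨D, hD, h2⟩ := ih2
    refine ⟨((2 * k + 1) * D + (1 + k ^ 2) * C) / δ, by positivity, fun n x hx => ?_⟩
    have h := one_sub_X_sq_mul_iterate_derivative_T_eval (R := ℝ) n k x
    have hN : 1 ≤ |(n : ℝ)| + 1 := by linarith [abs_nonneg (n : ℝ)]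
    set N := |(n : ℝ)| + 1 with hNdef
    have hn2 : |(n : ℝ) ^ 2 - k ^ 2| ≤ (1 + k ^ 2) * N ^ 2 := by
      have e : (n : ℝ) ^ 2 ≤ N ^ 2 := by
        rw [← sq_abs (n : ℝ)]
        gcongr
        linarith
      have e1 : (1 : ℝ) ≤ N ^ 2 := one_le_pow₀ hN
      refine (abs_sub _ _).trans ?_
      rw [abs_of_nonneg (by positivity), abs_of_nonneg (by positivity)]
      nlinarith [sq_nonneg (k : ℝ)]
    rw [div_mul_eq_mul_div, le_div_iff₀ hδ]
    calc |(derivative^[k + 2] (T ℝ n)).eval x| * δ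
        ≤ |(derivative^[k + 2] (T ℝ n)).eval x| * (1 - x ^ 2) := by gcongr; exact hden x hx
      _ = |(1 - x ^ 2) * (derivative^[k + 2] (T ℝ n)).eval x| := by
          rw [abs_mul, abs_of_nonneg (hδ.le.trans (hden x hx)), mul_comm]
      _ ≤ |(2 * k + 1) * x * (derivative^[k + 1] (T ℝ n)).eval x| +
          |(n ^ 2 - k ^ 2) * (derivative^[k] (T ℝ n)).eval x| := by rw [h]; exact abs_sub _ _
      _ = (2 * k + 1) * |x| * |(derivative^[k + 1] (T ℝ n)).eval x| +
          |(n : ℝ) ^ 2 - k ^ 2| * |(derivative^[k] (T ℝ n)).eval x| := by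
          rw [abs_mul, abs_mul, abs_mul, abs_of_nonneg (by positivity : (0 : ℝ) ≤ 2 * k + 1)]
      _ ≤ (2 * k + 1) * 1 * (D * N ^ (k + 1)) + (1 + k ^ 2) * N ^ 2 * (C * N ^ k) := by
          gcongr
          · exact habs x hx
          · exact h2 n x hx
          · exact h1 n x hx
      _ ≤ (2 * k + 1) * 1 * (D * N ^ (k + 2)) + (1 + k ^ 2) * N ^ 2 * (C * N ^ k) := by
          have : N ^ (k + 1) ≤ N ^ (k + 2) := pow_le_pow_right₀ hN (by simp)
          gcongr
      _ = ((2 * k + 1) * D + (1 + k ^ 2) * C) * N ^ (k + 2) := by ring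

theorem lobattoPoly_eval_cos (n : ℕ) (θ : ℝ) :
    (lobattoPoly ℝ n).eval (Real.cos θ) = -2 * (Real.sin θ * Real.sin (n * θ)) := by
  simp only [lobattoPoly, eval_sub, T_real_cos]
  push_cast
  rw [Real.cos_sub_cos]
  ring_nf

theorem lobattoPoly_eval_complex_cos (n : ℕ) (w : ℂ) :
    (lobattoPoly ℂ n).eval (Complex.cos w) = -2 * (Complex.sin w * Complex.sin (n * w)) := by
  simp only [lobattoPoly, eval_sub, T_complex_cos]
  push_cast
  rw [Complex.cos_sub_cos]
  ring_nf

theorem lobattoPoly_eval_node {n : ℕ} (hn : 1 ≤ n) (j : ℕ) :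
    (lobattoPoly ℝ n).eval (Real.cos (j * Real.pi / n)) = 0 := by
  have hn' : (n : ℝ) ≠ 0 := by positivity
  rw [lobattoPoly_eval_cos, mul_div_cancel₀ _ hn', Real.sin_nat_mul_pi]
  ring

theorem natDegree_lobattoPoly_le {n : ℕ} (hn : 1 ≤ n) :
    (lobattoPoly ℂ n).natDegree ≤ n + 1 := by
  refine (natDegree_sub_le _ _).trans ?_
  rw [natDegree_T, natDegree_T]
  omega

theorem lobattoPoly_eval_ofReal (n : ℕ) (x : ℝ) :
    (lobattoPoly ℂ n).eval (x : ℂ) = ((lobattoPoly ℝ n).eval x : ℝ) := by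
  simp [lobattoPoly, complex_ofReal_eval_T]

/-- Makes the cancellation in T_{n+1}' - T_{n-1}' visible: bounding the two terms separately would
lose a factor n. -/
theorem derivative_lobattoPoly (n : ℕ) :
    derivative (lobattoPoly ℝ n) = 2 * ((n : ℝ[X]) * T ℝ n + U ℝ (n - 1) * X) := by
  simp only [lobattoPoly, derivative_sub, T_derivative_eq_U]
  have h1 := U_add_one ℝ (n - 1)
  have h2 := T_eq_U_sub_X_mul_U ℝ n
  have e : (n : ℤ) - 1 + 1 = n := by ring
  rw [e] at h1
  rw [h2]
  push_cast
  rw [show (n : ℤ) + 1 - 1 = n by ring]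
  linear_combination (1 - n : ℝ[X]) * h1

theorem abs_lobattoPoly_le_two (n : ℕ) {x : ℝ} (hx : |x| ≤ 1) :
    |(lobattoPoly ℝ n).eval x| ≤ 2 := by
  rw [lobattoPoly, eval_sub]
  refine (abs_sub _ _).trans ?_
  linarith [abs_eval_T_real_le_one (n + 1) hx, abs_eval_T_real_le_one (n - 1) hx]

/-- From |sin nθ| ≤ n |sin θ|. The factor 1 - x² later cancels one power of the distance to a pole
beyond an endpoint. -/
theorem abs_lobattoPoly_le_mul (n : ℕ) {x : ℝ} (hx : |x| ≤ 1) :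
    |(lobattoPoly ℝ n).eval x| ≤ 2 * n * (1 - x ^ 2) := by
  obtain ⟨h1, h2⟩ := abs_le.1 hx
  rw [← Real.cos_arccos h1 h2, lobattoPoly_eval_cos]
  set θ := Real.arccos x
  have hs : ∀ k : ℕ, |Real.sin (k * θ)| ≤ k * |Real.sin θ| := by
    intro k
    induction k with
    | zero => simp
    | succ k ih =>
      push_cast
      rw [add_mul, one_mul, Real.sin_add]
      refine (abs_add_le _ _).trans ?_
      rw [abs_mul, abs_mul]
      have := mul_le_of_le_one_right (abs_nonneg (Real.sin (k * θ))) (Real.abs_cos_le_one θ)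
      have := mul_le_of_le_one_left (abs_nonneg (Real.sin θ)) (Real.abs_cos_le_one (k * θ))
      linarith
  rw [← Real.sin_sq, abs_mul, abs_mul, ← sq_abs (Real.sin θ)]
  norm_num
  nlinarith [mul_le_mul_of_nonneg_left (hs n) (abs_nonneg (Real.sin θ)), sq_abs (Real.sin θ)]

theorem exists_abs_iterate_derivative_lobattoPoly_le (i : ℕ) :
    ∃ C, 0 ≤ C ∧ ∀ (n : ℕ) (x : ℝ), 1 ≤ n → |x| ≤ 1 →
      |(derivative^[i] (lobattoPoly ℝ n)).eval x| ≤ C * (n : ℝ) ^ (2 * i - 1) := by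
  -- For i = 0 the truncated exponent 2i - 1 is 0, and the bound is |W| ≤ 2.
  rcases i with _ | i
  · exact ⟨2, by norm_num, fun n x _ hx => by simpa using abs_lobattoPoly_le_two n hx⟩
  refine ⟨4 + 2 * i, by positivity, fun n x hn hx => ?_⟩
  have hT := abs_iterate_derivative_T_le_pow n i hx
  have hU := abs_iterate_derivative_U_le_pow hn i hx
  have hU' : |(derivative^[i - 1] (U ℝ (n - 1))).eval x| * i ≤ (n : ℝ) ^ (2 * i + 1) * i := by
    gcongr
    refine (abs_iterate_derivative_U_le_pow hn (i - 1) hx).trans ?_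
    gcongr
    · exact_mod_cast hn
    · omega
  rw [Function.iterate_succ_apply, derivative_lobattoPoly, show (2 : ℝ[X]) = ((2 : ℕ) : ℝ[X]) by simp,
    iterate_derivative_natCast_mul, iterate_map_add, iterate_derivative_natCast_mul,
    iterate_derivative_mul_X]
  simp only [eval_mul, eval_add, eval_natCast, eval_X, nsmul_eq_mul]
  rw [show 2 * (i + 1) - 1 = 2 * i + 1 by omega]
  have e1 : |(n : ℝ) * (derivative^[i] (T ℝ n)).eval x| ≤ (n : ℝ) ^ (2 * i + 1) := by
    rw [abs_mul, Nat.abs_cast, pow_succ']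
    push_cast at hT
    gcongr
  have e2 : |(derivative^[i] (U ℝ (n - 1))).eval x * x| ≤ (n : ℝ) ^ (2 * i + 1) := by
    rw [abs_mul]
    exact (mul_le_of_le_one_right (abs_nonneg _) hx).trans hU
  have e3 : |(i : ℝ) * (derivative^[i - 1] (U ℝ (n - 1))).eval x| ≤ (n : ℝ) ^ (2 * i + 1) * i := by
    rw [abs_mul, Nat.abs_cast, mul_comm]
    exact hU'
  rw [abs_mul]
  refine (mul_le_mul_of_nonneg_left ((abs_add_le _ _).trans (add_le_add e1
    ((abs_add_le _ _).trans (add_le_add e2 e3)))) (abs_nonneg _)).trans_eq ?_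
  norm_num
  ring

theorem exists_abs_iterate_derivative_lobattoPoly_le_of_abs_le {δ : ℝ} (hδ : 0 < δ) (hδ1 : δ ≤ 1)
    (i : ℕ) :
    ∃ C, 0 ≤ C ∧ ∀ (n : ℕ) (x : ℝ), 1 ≤ n → |x| ≤ 1 - δ →
      |(derivative^[i] (lobattoPoly ℝ n)).eval x| ≤ C * (n : ℝ) ^ i := by
  obtain ⟨C, hC, h⟩ := exists_abs_iterate_derivative_T_le hδ hδ1 i
  refine ⟨2 * C * 3 ^ i, by positivity, fun n x hn hx => ?_⟩
  rw [lobattoPoly, iterate_derivative_sub, eval_sub]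
  have hn' : (1 : ℝ) ≤ n := by exact_mod_cast hn
  have h1 : (|(((n : ℤ) + 1 : ℤ) : ℝ)| + 1) ^ i ≤ (3 * n) ^ i := by
    push_cast
    rw [abs_of_nonneg (by positivity)]
    gcongr
    linarith
  have h2 : (|(((n : ℤ) - 1 : ℤ) : ℝ)| + 1) ^ i ≤ (3 * n) ^ i := by
    push_cast
    rw [abs_of_nonneg (by linarith)]
    gcongr
    linarith
  calc _ ≤ C * (3 * n) ^ i + C * (3 * n) ^ i :=
        (abs_sub _ _).trans (add_le_add ((h _ x hx).trans (by gcongr)) ((h _ x hx).trans (by gcongr)))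
    _ = _ := by rw [mul_pow]; ring

end ChebyshevBounds

/-! ### Complex sine and cosine, growth of sinh, comparison of angles. -/

section SineBounds

theorem normSq_complex_sin (z : ℂ) :
    Complex.normSq (Complex.sin z) = Real.sin z.re ^ 2 + Real.sinh z.im ^ 2 := by
  have h : Complex.sin z = ((Real.sin z.re * Real.cosh z.im : ℝ) : ℂ) +
      ((Real.cos z.re * Real.sinh z.im : ℝ) : ℂ) * Complex.I := by
    rw [Complex.sin_eq]
    push_cast
    ring
  rw [h, Complex.normSq_add_mul_I]
  nlinarith [Real.sin_sq_add_cos_sq z.re, Real.cosh_sq z.im]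

theorem abs_sin_re_le_norm_sin (z : ℂ) : |Real.sin z.re| ≤ ‖Complex.sin z‖ := by
  refine abs_le_of_sq_le_sq ?_ (norm_nonneg _)
  rw [Complex.sq_norm, normSq_complex_sin]
  nlinarith [sq_nonneg (Real.sinh z.im)]

theorem sinh_abs_im_le_norm_sin (z : ℂ) : Real.sinh |z.im| ≤ ‖Complex.sin z‖ := by
  rw [← Real.abs_sinh]
  refine abs_le_of_sq_le_sq ?_ (norm_nonneg _)
  rw [Complex.sq_norm, normSq_complex_sin]
  nlinarith [sq_nonneg (Real.sin z.re)]

theorem norm_cos_le_cosh_abs_im (z : ℂ) : ‖Complex.cos z‖ ≤ Real.cosh |z.im| := by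
  have h : Complex.cos z = ((Real.cos z.re * Real.cosh z.im : ℝ) : ℂ) +
      ((-(Real.sin z.re * Real.sinh z.im) : ℝ) : ℂ) * Complex.I := by
    rw [Complex.cos_eq]
    push_cast
    ring
  rw [Real.cosh_abs]
  refine abs_le_of_sq_le_sq' ?_ (Real.cosh_pos _).le |>.2
  rw [Complex.sq_norm, h, Complex.normSq_add_mul_I]
  nlinarith [Real.sin_sq_add_cos_sq z.re, Real.cosh_sq z.im, sq_nonneg (Real.sin z.re),
    sq_nonneg (Real.sinh z.im)]

theorem abs_im_cos_le_sinh (z : ℂ) : |(Complex.cos z).im| ≤ Real.sinh |z.im| := by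
  have h : (Complex.cos z).im = -(Real.sin z.re * Real.sinh z.im) := by
    have e : Complex.cos z = ((Real.cos z.re * Real.cosh z.im : ℝ) : ℂ) +
        ((-(Real.sin z.re * Real.sinh z.im) : ℝ) : ℂ) * Complex.I := by
      rw [Complex.cos_eq]
      push_cast
      ring
    rw [e, Complex.add_im, Complex.im_ofReal_mul]
    simp [Complex.I_im, -Complex.ofReal_mul, -Complex.ofReal_cos, -Complex.ofReal_cosh]
  rw [h, abs_neg, abs_mul, ← Real.abs_sinh]
  exact mul_le_of_le_one_left (abs_nonneg _) (Real.abs_sin_le_one _)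

theorem natCast_mul_sinh_le {x : ℝ} (hx : 0 ≤ x) (n : ℕ) :
    n * Real.sinh x ≤ Real.sinh (n * x) := by
  induction n with
  | zero => simp
  | succ n ih =>
    push_cast
    rw [add_mul, one_mul, add_mul, one_mul, Real.sinh_add]
    have h1 := Real.one_le_cosh x
    have h2 := Real.one_le_cosh (n * x)
    have h3 := Real.sinh_nonneg_iff.2 hx
    have h4 : 0 ≤ Real.sinh (n * x) := Real.sinh_nonneg_iff.2 (by positivity)
    nlinarith

theorem sinh_pow_le {x : ℝ} (hx : 0 ≤ x) (r : ℕ) :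
    Real.sinh x ^ (r + 1) ≤ Real.sinh ((r + 1 : ℕ) * x) := by
  induction r with
  | zero => simp
  | succ r ih =>
    have e : ((r + 1 + 1 : ℕ) : ℝ) * x = (r + 1 : ℕ) * x + x := by push_cast; ring
    rw [pow_succ, e, Real.sinh_add]
    have h1 := Real.one_le_cosh x
    have h3 := Real.sinh_nonneg_iff.2 hx
    have h4 : 0 ≤ Real.sinh ((r + 1 : ℕ) * x) := Real.sinh_nonneg_iff.2 (by positivity)
    have h5 := Real.sinh_lt_cosh ((r + 1 : ℕ) * x)
    nlinarith

/-- Superpolynomial growth of `n ↦ sinh (n x)`, uniform in `x`. -/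
theorem exists_mul_le_sinh (r : ℕ) :
    ∃ c, 0 < c ∧ ∀ (n : ℕ) (x u : ℝ), r + 1 ≤ n → 0 ≤ u → 0 ≤ x → u ≤ Real.sinh x →
      c * (n * u * (1 + (n * u) ^ r)) ≤ Real.sinh (n * x) := by
  refine ⟨(1 + (2 * (r + 1 : ℝ)) ^ (r + 1))⁻¹, by positivity, fun n x u hn hu hx hux => ?_⟩
  rw [inv_mul_le_iff₀ (by positivity)]
  have h1 : n * u ≤ Real.sinh (n * x) :=
    (mul_le_mul_of_nonneg_left hux n.cast_nonneg).trans (natCast_mul_sinh_le hx n)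
  have h2 : (n * u) ^ (r + 1) ≤ (2 * (r + 1 : ℝ)) ^ (r + 1) * Real.sinh (n * x) := by
    -- Split nx into r + 1 pieces of length at least qx. Each contributes a factor sinh(qx) ≥ qu,
    -- and q is at least n / (2(r + 1)).
    set q := n / (r + 1) with hq
    have hq1 : 1 ≤ q := by rw [hq]; exact (Nat.one_le_div_iff (by omega)).2 hn
    have hnq : n ≤ 2 * (r + 1) * q := by
      have := Nat.lt_div_mul_add (a := n) (b := r + 1) (by omega)
      rw [← hq] at this
      nlinarith
    have hqn : (r + 1) * q ≤ n := Nat.mul_div_le n (r + 1)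
    have h3 : Real.sinh (q * x) ^ (r + 1) ≤ Real.sinh (n * x) := by
      refine (sinh_pow_le (by positivity) r).trans (Real.sinh_le_sinh.2 ?_)
      rw [← mul_assoc]
      gcongr
      exact_mod_cast hqn
    have h4 : n * u ≤ 2 * (r + 1) * Real.sinh (q * x) := by
      calc n * u ≤ (2 * (r + 1) * q : ℕ) * Real.sinh x := by gcongr
        _ = 2 * (r + 1) * (q * Real.sinh x) := by push_cast; ring
        _ ≤ _ := by gcongr; exact natCast_mul_sinh_le hx q
    calc (n * u) ^ (r + 1) ≤ (2 * (r + 1) * Real.sinh (q * x)) ^ (r + 1) := by gcongr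
      _ = (2 * (r + 1 : ℝ)) ^ (r + 1) * Real.sinh (q * x) ^ (r + 1) := by rw [mul_pow]
      _ ≤ _ := by gcongr
  calc n * u * (1 + (n * u) ^ r) = n * u + (n * u) ^ (r + 1) := by ring
    _ ≤ _ := by linarith

/-- A substitute for the mean value theorem with the sine taken at the endpoint θ. In the product
formula for cos θ - cos φ, Jordan's inequality handles the half difference, and the sine of the half
sum is at least sin θ / 2. -/
theorem sin_mul_abs_sub_le {θ φ : ℝ} (hθ : θ ∈ Set.Icc 0 Real.pi) (hφ : φ ∈ Set.Icc 0 Real.pi) :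
    Real.sin θ * |θ - φ| ≤ Real.pi * |Real.cos θ - Real.cos φ| := by
  obtain ⟨hθ0, hθ1⟩ := hθ
  obtain ⟨hφ0, hφ1⟩ := hφ
  have hpi := Real.pi_pos
  have h1 : 2 / Real.pi * |(θ - φ) / 2| ≤ |Real.sin ((θ - φ) / 2)| := by
    refine Real.mul_abs_le_abs_sin ?_
    rw [abs_le]
    constructor <;> linarith
  have h2 : Real.sin θ / 2 ≤ Real.sin ((θ + φ) / 2) := by
    have e : Real.sin θ = 2 * Real.sin (θ / 2) * Real.cos (θ / 2) := by
      rw [← Real.sin_two_mul]; ring_nf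
    rw [e, add_div, Real.sin_add]
    have a1 : 0 ≤ Real.sin (θ / 2) := Real.sin_nonneg_of_nonneg_of_le_pi (by linarith) (by linarith)
    have a2 : 0 ≤ Real.cos (θ / 2) := Real.cos_nonneg_of_neg_pi_div_two_le_of_le (by linarith) (by linarith)
    have b1 : 0 ≤ Real.sin (φ / 2) := Real.sin_nonneg_of_nonneg_of_le_pi (by linarith) (by linarith)
    have b2 : 0 ≤ Real.cos (φ / 2) := Real.cos_nonneg_of_neg_pi_div_two_le_of_le (by linarith) (by linarith)
    have c1 := Real.sin_le_one (θ / 2)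
    have c2 := Real.cos_le_one (θ / 2)
    have d : 1 ≤ Real.sin (φ / 2) + Real.cos (φ / 2) := by
      nlinarith [Real.sin_sq_add_cos_sq (φ / 2), Real.sin_le_one (φ / 2), Real.cos_le_one (φ / 2)]
    -- With a = sin(θ/2) and b = cos(θ/2), both in [0, 1], a cos(φ/2) + b sin(φ/2) ≥ ab (cos(φ/2) +
    -- sin(φ/2)) ≥ ab.
    nlinarith [mul_nonneg a1 a2, mul_nonneg (mul_nonneg a1 (sub_nonneg.2 c2)) b2,
      mul_nonneg (mul_nonneg a2 (sub_nonneg.2 c1)) b1,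
      mul_nonneg (mul_nonneg a1 a2) (sub_nonneg.2 d)]
  have h3 : 0 ≤ Real.sin θ := Real.sin_nonneg_of_nonneg_of_le_pi hθ0 hθ1
  have h1' : |θ - φ| ≤ Real.pi * |Real.sin ((θ - φ) / 2)| := by
    rw [abs_div, abs_of_pos (two_pos : (0 : ℝ) < 2)] at h1
    calc |θ - φ| = Real.pi * (2 / Real.pi * (|θ - φ| / 2)) := by field_simp
      _ ≤ _ := by gcongr
  rw [Real.cos_sub_cos, abs_mul, abs_mul, abs_of_nonneg (by linarith : 0 ≤ Real.sin ((θ + φ) / 2))]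
  norm_num
  calc Real.sin θ * |θ - φ| ≤ (2 * Real.sin ((θ + φ) / 2)) * (Real.pi * |Real.sin ((θ - φ) / 2)|) := by
        have h4 : Real.sin θ ≤ 2 * Real.sin ((θ + φ) / 2) := by linarith
        have h5 := h3.trans h4
        gcongr
    _ = _ := by ring

/-- Folding an angle into [0, π] is harmless because sin²(nψ) = 1 - T_n(cos ψ)² depends only on cos
ψ. -/
theorem abs_sin_mul_arccos_cos (n : ℕ) (φ : ℝ) :
    |Real.sin (n * Real.arccos (Real.cos φ))| = |Real.sin (n * φ)| := by
  have h : ∀ ψ, Real.sin (n * ψ) ^ 2 = 1 - ((Polynomial.Chebyshev.T ℝ n).eval (Real.cos ψ)) ^ 2 := by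
    intro ψ
    rw [Polynomial.Chebyshev.T_real_cos, Real.sin_sq]
    push_cast
    rfl
  rw [← sq_eq_sq_iff_abs_eq_abs, h, h, Real.cos_arccos (Real.neg_one_le_cos _) (Real.cos_le_one _)]

theorem abs_cos_sub_cos_re_le (θ : ℝ) (w : ℂ) :
    |Real.cos θ - Real.cos w.re| ≤ ‖(Real.cos θ : ℂ) - Complex.cos w‖ := by
  rw [Complex.ofReal_cos, Complex.cos_sub_cos, Real.cos_sub_cos, abs_mul, abs_mul, norm_mul, norm_mul]
  have h1 := abs_sin_re_le_norm_sin ((θ + w) / 2)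
  have h2 := abs_sin_re_le_norm_sin ((θ - w) / 2)
  have e1 : (((θ : ℂ) + w) / 2).re = (θ + w.re) / 2 := by simp
  have e2 : (((θ : ℂ) - w) / 2).re = (θ - w.re) / 2 := by simp
  rw [e1] at h1
  rw [e2] at h2
  gcongr
  simp

end SineBounds

/-! ### Lower bounds for the node polynomial at a complex pole. -/

section LowerBounds

open Polynomial

theorem norm_lobattoPoly_cos (n : ℕ) (w : ℂ) :
    ‖(lobattoPoly ℂ n).eval (Complex.cos w)‖ =
      2 * (‖Complex.sin w‖ * ‖Complex.sin (n * w)‖) := by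
  rw [lobattoPoly_eval_complex_cos, norm_mul, norm_mul]
  simp

theorem sinh_mul_abs_im_le (n : ℕ) (w : ℂ) :
    Real.sinh (n * |w.im|) ≤ ‖Complex.sin (n * w)‖ := by
  have := sinh_abs_im_le_norm_sin (n * w)
  rwa [show ((n : ℂ) * w).im = n * w.im by simp, abs_mul, Nat.abs_cast] at this

theorem one_sub_abs_re_le_norm_sin (w : ℂ) (hre : |(Complex.cos w).re| ≤ 1) :
    1 - |(Complex.cos w).re| ≤ ‖Complex.sin w‖ := by
  set t := Complex.cos w
  have h : ‖Complex.sin w‖ ^ 2 = ‖1 - t‖ * ‖1 + t‖ := by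
    rw [← norm_pow, ← norm_mul, Complex.sin_sq]
    congr 1
    ring
  have h1 : 1 - |t.re| ≤ ‖1 - t‖ := by
    refine le_trans ?_ (Complex.abs_re_le_norm _)
    simp only [Complex.sub_re, Complex.one_re]
    refine le_trans ?_ (le_abs_self _)
    linarith [le_abs_self t.re]
  have h2 : 1 - |t.re| ≤ ‖1 + t‖ := by
    refine le_trans ?_ (Complex.abs_re_le_norm _)
    simp only [Complex.add_re, Complex.one_re]
    refine le_trans ?_ (le_abs_self _)
    linarith [neg_abs_le t.re]
  refine abs_le_of_sq_le_sq' ?_ (norm_nonneg _) |>.2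
  rw [h, sq]
  gcongr

/-- Put t = cos w, so that |W(t)| = 2 |sin w| |sin nw|. The first sine is at least 1 - |ξ|; the
second is at least sinh(n |Im w|), where sinh |Im w| ≥ |Im t|. -/
theorem exists_le_norm_lobattoPoly_of_re {ξ : ℝ} (hξ : |ξ| < 1) (r : ℕ) :
    ∃ c, 0 < c ∧ ∀ (n : ℕ) (t : ℂ), r + 1 ≤ n → t.re = ξ →
      c * (n * |t.im| * (1 + (n * |t.im|) ^ r)) ≤ ‖(lobattoPoly ℂ n).eval t‖ := by
  obtain ⟨c, hc, h⟩ := exists_mul_le_sinh r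
  refine ⟨2 * ((1 - |ξ|) * c), by have := sub_pos.2 hξ; positivity, fun n t hn ht => ?_⟩
  obtain ⟨w, rfl⟩ := Complex.cos_surjective t
  rw [norm_lobattoPoly_cos, mul_assoc, mul_assoc]
  have h1 := h n |w.im| _ hn (abs_nonneg _) (abs_nonneg _) (abs_im_cos_le_sinh w)
  have h2 := one_sub_abs_re_le_norm_sin w (by rw [ht]; exact hξ.le)
  rw [ht] at h2
  gcongr
  exact h1.trans (sinh_mul_abs_im_le n w)

/-- With t = cos w, |t| ≥ 1 + s forces cosh |Im w| ≥ 1 + s, hence sinh |Im w| ≥ √s. Both sine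
factors contribute a √s, whence the factor ns. -/
theorem exists_le_norm_lobattoPoly_of_norm (r : ℕ) :
    ∃ c, 0 < c ∧ ∀ (n : ℕ) (t : ℂ) (s : ℝ), r + 1 ≤ n → 0 ≤ s → 1 + s ≤ ‖t‖ →
      c * (n * s * (1 + (n * √s) ^ r)) ≤ ‖(lobattoPoly ℂ n).eval t‖ := by
  obtain ⟨c, hc, h⟩ := exists_mul_le_sinh r
  refine ⟨2 * c, by positivity, fun n t s hn hs ht => ?_⟩
  obtain ⟨w, rfl⟩ := Complex.cos_surjective t
  have h1 : √s ≤ Real.sinh |w.im| := by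
    have h2 := ht.trans (norm_cos_le_cosh_abs_im w)
    rw [Real.sqrt_le_left (Real.sinh_nonneg_iff.2 (abs_nonneg _))]
    nlinarith [Real.cosh_sq |w.im|]
  have h3 := h n |w.im| _ hn (Real.sqrt_nonneg s) (abs_nonneg _) h1
  rw [norm_lobattoPoly_cos]
  calc 2 * c * (n * s * (1 + (n * √s) ^ r))
      = 2 * c * (n * (√s * √s) * (1 + (n * √s) ^ r)) := by rw [Real.mul_self_sqrt hs]
    _ = 2 * (√s * (c * (n * √s * (1 + (n * √s) ^ r)))) := by ring
    _ ≤ _ := by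
        gcongr
        · exact h1.trans (sinh_abs_im_le_norm_sin w)
        · exact h3.trans (sinh_mul_abs_im_le n w)

/-- Needed when n |Im t| is small: the lower bound on W(t) alone would then lose a factor 1 / (n |Im
t|). Comparing W(x) with W(t) directly, the change of sin(nθ) between the two angles costs n |θ -
φ|, which sin θ converts into n |x - t|, and n |Im t| ≤ |sin nw|. -/
theorem abs_lobattoPoly_le_norm_mul {ξ : ℝ} (hξ : |ξ| < 1) (n : ℕ) {x : ℝ} (hx : |x| ≤ 1)
    {t : ℂ} (ht : t.re = ξ) (him : t.im ≠ 0) :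
    |(lobattoPoly ℝ n).eval x| ≤
      5 / (1 - |ξ|) * (‖(lobattoPoly ℂ n).eval t‖ * (‖(x : ℂ) - t‖ / |t.im|)) := by
  obtain ⟨w, rfl⟩ := Complex.cos_surjective t
  obtain ⟨hx1, hx2⟩ := abs_le.1 hx
  set θ := Real.arccos x with hθ
  have hxθ : x = Real.cos θ := (Real.cos_arccos hx1 hx2).symm
  set φ := Real.arccos (Real.cos w.re) with hφ
  have hcφ : Real.cos φ = Real.cos w.re := Real.cos_arccos (Real.neg_one_le_cos _) (Real.cos_le_one _)
  have hθm : θ ∈ Set.Icc 0 Real.pi := ⟨Real.arccos_nonneg x, Real.arccos_le_pi x⟩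
  have hφm : φ ∈ Set.Icc 0 Real.pi := ⟨Real.arccos_nonneg _, Real.arccos_le_pi _⟩
  have hs0 : 0 ≤ Real.sin θ := Real.sin_nonneg_of_nonneg_of_le_pi hθm.1 hθm.2
  set v := |(Complex.cos w).im| with hv
  have hv0 : 0 < v := abs_pos.2 him
  have hvs := abs_im_cos_le_sinh w
  rw [← hv] at hvs
  set D := ‖(x : ℂ) - Complex.cos w‖ with hD
  have hvD : v ≤ D := by
    have := Complex.abs_im_le_norm ((x : ℂ) - Complex.cos w)
    simpa [hv] using this
  set S := ‖Complex.sin (n * w)‖ with hS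
  have hnv : n * v ≤ S := by
    calc n * v ≤ n * Real.sinh |w.im| := by gcongr
      _ ≤ _ := (natCast_mul_sinh_le (abs_nonneg _) n).trans (sinh_mul_abs_im_le n w)
  have h1 : |Real.sin (n * φ)| ≤ S := by
    rw [hφ, abs_sin_mul_arccos_cos]
    have := abs_sin_re_le_norm_sin (n * w)
    rwa [show ((n : ℂ) * w).re = n * w.re by simp] at this
  have h2 : Real.sin θ * |θ - φ| ≤ Real.pi * D := by
    refine (sin_mul_abs_sub_le hθm hφm).trans ?_
    rw [hcφ, hD, hxθ]
    gcongr
    exact abs_cos_sub_cos_re_le θ w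
  have h3 : |Real.sin (n * θ)| ≤ S + n * |θ - φ| := by
    have : |Real.sin (n * θ) - Real.sin (n * φ)| ≤ |n * θ - n * φ| := by
      rw [Real.sin_sub_sin, abs_mul, abs_mul, abs_two]
      have h4 : |Real.sin ((n * θ - n * φ) / 2)| ≤ |(n * θ - n * φ) / 2| := Real.abs_sin_le_abs
      rw [abs_div, abs_two] at h4
      have h5 := Real.abs_cos_le_one ((n * θ + n * φ) / 2)
      nlinarith [abs_nonneg (Real.sin ((n * θ - n * φ) / 2))]
    rw [← mul_sub, abs_mul, Nat.abs_cast] at this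
    have h4 := abs_sub_abs_le_abs_sub (Real.sin (n * θ)) (Real.sin (n * φ))
    linarith
  -- The 5 is 1 + 4, from D/v ≥ 1 and π ≤ 4.
  have h5 : Real.sin θ * |Real.sin (n * θ)| ≤ S * (5 * (D / v)) := by
    have hDv : 1 ≤ D / v := (one_le_div hv0).2 hvD
    calc Real.sin θ * |Real.sin (n * θ)| ≤ Real.sin θ * (S + n * |θ - φ|) := by gcongr
      _ = Real.sin θ * S + n * (Real.sin θ * |θ - φ|) := by ring
      _ ≤ 1 * S + n * (Real.pi * D) := by
          have := Real.sin_le_one θ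
          gcongr
      _ = S + (n * v) * (Real.pi * (D / v)) := by field_simp
      _ ≤ S * (D / v) + S * (4 * (D / v)) := by
          have := Real.pi_le_four
          have hS0 : 0 ≤ S := norm_nonneg _
          gcongr
          nlinarith
      _ = _ := by ring
  have h6 := one_sub_abs_re_le_norm_sin w (by rw [ht]; exact hξ.le)
  rw [ht] at h6
  have h7 := sub_pos.2 hξ
  rw [norm_lobattoPoly_cos, hxθ, lobattoPoly_eval_cos, abs_mul, abs_mul, abs_of_nonneg hs0]
  norm_num
  rw [div_mul_eq_mul_div, le_div_iff₀ h7]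
  calc 2 * (Real.sin θ * |Real.sin (n * θ)|) * (1 - |ξ|)
      ≤ 2 * (S * (5 * (D / v))) * ‖Complex.sin w‖ := by gcongr
    _ = _ := by rw [hD, hxθ, Complex.ofReal_cos]; ring

end LowerBounds

/-! ### Derivatives of the interpolation error of a Cauchy kernel. -/

section Kernel

open Polynomial

/-- The interpolation error at `x` of the Cauchy kernel with pole `t`. -/
noncomputable def interpKernel (n : ℕ) (t : ℂ) (x : ℝ) : ℂ :=
  ((lobattoPoly ℝ n).eval x : ℝ) * ((x : ℂ) - t)⁻¹ / (lobattoPoly ℂ n).eval t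

theorem iteratedDeriv_ofReal_eval (p : ℝ[X]) (k : ℕ) :
    iteratedDeriv k (fun x : ℝ => ((p.eval x : ℝ) : ℂ)) =
      fun x => (((derivative^[k] p).eval x : ℝ) : ℂ) := by
  induction k with
  | zero => simp
  | succ k ih =>
    rw [iteratedDeriv_succ, ih]
    funext x
    rw [Function.iterate_succ_apply']
    exact ((derivative^[k] p).hasDerivAt x).ofReal_comp.deriv

theorem contDiff_ofReal_eval (p : ℝ[X]) (k : WithTop ℕ∞) :
    ContDiff ℝ k (fun x : ℝ => ((p.eval x : ℝ) : ℂ)) := by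
  have h : ContDiff ℝ k (fun x : ℝ => p.eval x) := by
    simpa only [Polynomial.coe_aeval_eq_eval] using p.contDiff_aeval (𝕜 := ℝ) k
  exact Complex.ofRealCLM.contDiff.comp h

theorem isOpen_ne_ofReal (t : ℂ) : IsOpen {x : ℝ | (x : ℂ) ≠ t} :=
  isOpen_ne.preimage Complex.continuous_ofReal

theorem iteratedDeriv_ofReal_sub_inv (t : ℂ) (k : ℕ) {x : ℝ} (hx : (x : ℂ) ≠ t) :
    iteratedDeriv k (fun x : ℝ => ((x : ℂ) - t)⁻¹) x =
      (-1) ^ k * k.factorial * (((x : ℂ) - t) ^ (k + 1))⁻¹ := by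
  induction k generalizing x with
  | zero => simp
  | succ k ih =>
    have hev : iteratedDeriv k (fun x : ℝ => ((x : ℂ) - t)⁻¹) =ᶠ[nhds x]
        fun x : ℝ => (-1) ^ k * k.factorial * (((x : ℂ) - t) ^ (k + 1))⁻¹ := by
      filter_upwards [(isOpen_ne_ofReal t).mem_nhds hx] with y hy using ih hy
    rw [iteratedDeriv_succ, hev.deriv_eq]
    have h0 : (x : ℂ) - t ≠ 0 := sub_ne_zero.2 hx
    have h1 : HasDerivAt (fun x : ℝ => (x : ℂ) - t) 1 x :=
      (HasDerivAt.ofReal_comp (hasDerivAt_id x)).sub_const t |>.congr_deriv (by simp)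
    have h2 := (((h1.fun_pow (k + 1)).fun_inv (pow_ne_zero _ h0)).const_mul
      ((-1) ^ k * (k.factorial : ℂ))).deriv
    refine Eq.trans (by rfl) (h2.trans ?_)
    rw [Nat.factorial_succ]
    push_cast
    field_simp
    ring

theorem contDiffAt_ofReal_sub_inv (t : ℂ) (k : WithTop ℕ∞) {x : ℝ} (hx : (x : ℂ) ≠ t) :
    ContDiffAt ℝ k (fun x : ℝ => ((x : ℂ) - t)⁻¹) x :=
  (Complex.ofRealCLM.contDiff.contDiffAt.sub contDiffAt_const).inv (sub_ne_zero.2 hx)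

theorem contDiffAt_interpKernel (n : ℕ) (t : ℂ) (k : WithTop ℕ∞) {x : ℝ} (hx : (x : ℂ) ≠ t) :
    ContDiffAt ℝ k (interpKernel n t) x := by
  unfold interpKernel
  simp only [div_eq_mul_inv]
  exact ((contDiff_ofReal_eval _ k).contDiffAt.mul (contDiffAt_ofReal_sub_inv t k hx)).mul
    contDiffAt_const

theorem iteratedDeriv_interpKernel (n m : ℕ) (t : ℂ) {x : ℝ} (hx : (x : ℂ) ≠ t) :
    iteratedDeriv m (interpKernel n t) x =
      (∑ i ∈ Finset.range (m + 1), (m.choose i : ℂ) *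
        (((derivative^[i] (lobattoPoly ℝ n)).eval x : ℝ) : ℂ) *
        ((-1) ^ (m - i) * (m - i).factorial * (((x : ℂ) - t) ^ (m - i + 1))⁻¹)) *
        ((lobattoPoly ℂ n).eval t)⁻¹ := by
  have h : interpKernel n t = fun x : ℝ =>
      (((lobattoPoly ℝ n).eval x : ℝ) : ℂ) * ((x : ℂ) - t)⁻¹ * ((lobattoPoly ℂ n).eval t)⁻¹ := by
    funext y
    rw [interpKernel, div_eq_mul_inv]
  rw [h, iteratedDeriv_mul_const_field]
  congr 1
  refine (iteratedDeriv_mul (contDiff_ofReal_eval _ m).contDiffAt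
    (contDiffAt_ofReal_sub_inv t m hx)).trans ?_
  refine Finset.sum_congr rfl fun i _ => ?_
  rw [iteratedDeriv_ofReal_eval, iteratedDeriv_ofReal_sub_inv t _ hx]

theorem norm_iteratedDeriv_interpKernel_le {n m : ℕ} {t : ℂ} {x : ℝ} (hx : (x : ℂ) ≠ t)
    {K : ℕ → ℕ → ℝ} {B : ℝ}
    (h : ∀ i l, i + l = m → |(derivative^[i] (lobattoPoly ℝ n)).eval x| /
      (‖(x : ℂ) - t‖ ^ (l + 1) * ‖(lobattoPoly ℂ n).eval t‖) ≤ K i l * B) :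
    ‖iteratedDeriv m (interpKernel n t) x‖ ≤
      (∑ i ∈ Finset.range (m + 1), m.choose i * (m - i).factorial * K i (m - i)) * B := by
  rw [iteratedDeriv_interpKernel n m t hx, Finset.sum_mul, Finset.sum_mul]
  refine norm_sum_le_of_le _ fun i hi => ?_
  have hi' : i + (m - i) = m := by have := Finset.mem_range.1 hi; omega
  have := mul_le_mul_of_nonneg_left (h i (m - i) hi')
    (by positivity : (0 : ℝ) ≤ m.choose i * (m - i).factorial)
  rw [mul_assoc _ (K i (m - i))]
  refine le_trans (le_of_eq ?_) this
  simp only [norm_mul, norm_inv, norm_pow, norm_neg, norm_one, one_pow, one_mul,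
    Complex.norm_natCast, Complex.norm_real, Real.norm_eq_abs]
  field_simp

/-- Lets surplus decay in W(t) absorb the powers of u = n |Im t| or n√s produced by differentiating
W. -/
theorem pow_mul_one_add_pow_le {u : ℝ} (hu : 0 ≤ u) {a r b : ℕ} (h : a + r ≤ b) :
    u ^ a * (1 + u ^ r) ≤ 2 * (1 + u ^ b) := by
  have key : ∀ k, k ≤ b → u ^ k ≤ 1 + u ^ b := by
    intro k hk
    rcases le_total u 1 with h1 | h1
    · have := pow_le_one₀ hu h1 (n := k)
      have : 0 ≤ u ^ b := by positivity
      linarith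
    · linarith [pow_le_pow_right₀ h1 hk]
  have h1 := key a (by omega)
  have h2 := key (a + r) h
  rw [pow_add] at h2
  linarith

/-- Bound for the derivatives of the kernel away from the endpoints, for a pole on a vertical
line. -/
theorem exists_norm_iteratedDeriv_interpKernel_le_interior {ξ : ℝ} (hξ : |ξ| < 1) {δ : ℝ}
    (hδ : 0 < δ) (hδ1 : δ ≤ 1) (m r : ℕ) :
    ∃ C, 0 ≤ C ∧ ∀ (n : ℕ) (x : ℝ) (t : ℂ), r + m + 1 ≤ n → |x| ≤ 1 - δ → t.re = ξ → t.im ≠ 0 →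
      ‖iteratedDeriv m (interpKernel n t) x‖ ≤
        C * (1 / (|t.im| ^ (m + 1) * (1 + (n * |t.im|) ^ r))) := by
  have key : ∀ i l : ℕ, ∃ C, 0 ≤ C ∧ ∀ (n : ℕ) (x : ℝ) (t : ℂ), r + i + 1 ≤ n → |x| ≤ 1 - δ →
      t.re = ξ → t.im ≠ 0 → |(derivative^[i] (lobattoPoly ℝ n)).eval x| /
      (‖(x : ℂ) - t‖ ^ (l + 1) * ‖(lobattoPoly ℂ n).eval t‖) ≤
        C * (1 / (|t.im| ^ (i + l + 1) * (1 + (n * |t.im|) ^ r))) := by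
    intro i l
    -- The i extra powers of decay pay for the i derivatives of W.
    obtain ⟨c, hc, hlow⟩ := exists_le_norm_lobattoPoly_of_re hξ (r + i)
    rcases i with _ | j
    · have hK : 0 ≤ 5 / (1 - |ξ|) := by have := sub_pos.2 hξ; positivity
      set K := 5 / (1 - |ξ|)
      refine ⟨2 * K + 2 / c, by positivity, fun n x t hn hx ht him => ?_⟩
      have hx1 : |x| ≤ 1 := by linarith
      have hv : 0 < |t.im| := abs_pos.2 him
      have hup := abs_lobattoPoly_le_norm_mul hξ n hx1 ht him
      have hlo := hlow n t (by omega) ht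
      have hD : |t.im| ≤ ‖(x : ℂ) - t‖ := by
        simpa using Complex.abs_im_le_norm ((x : ℂ) - t)
      set v := |t.im|
      set D := ‖(x : ℂ) - t‖
      set N := ‖(lobattoPoly ℂ n).eval t‖
      have hn' : (0 : ℝ) < n := by exact_mod_cast (by omega : 0 < n)
      have hu : 0 < n * v := by positivity
      simp only [add_zero] at hlo
      have hN : 0 < N := lt_of_lt_of_le (by positivity) hlo
      have hD0 : 0 < D := hv.trans_le hD
      simp only [Function.iterate_zero, id_eq, zero_add]
      have hDl : v ^ l ≤ D ^ l := by gcongr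
      have hDl' : v ^ (l + 1) ≤ D ^ (l + 1) := by gcongr
      -- For nv ≤ 1 the direct comparison of W(x) with W(t) is used. For nv ≥ 1 the factor nv in the
      -- lower bound can be discarded.
      rcases le_total (n * v) 1 with h1 | h1
      · have h2 : (n * v) ^ r ≤ 1 := pow_le_one₀ hu.le h1
        calc |(lobattoPoly ℝ n).eval x| / (D ^ (l + 1) * N)
            ≤ K * (N * (D / v)) / (D ^ (l + 1) * N) := by gcongr
          _ = K * (1 / (v * D ^ l)) := by rw [pow_succ]; field_simp
          _ ≤ K * (1 / (v * v ^ l)) := by gcongr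
          _ = 2 * K * (1 / (v ^ (l + 1) * (1 + 1))) := by field_simp; ring
          _ ≤ 2 * K * (1 / (v ^ (l + 1) * (1 + (n * v) ^ r))) := by gcongr
          _ ≤ (2 * K + 2 / c) * (1 / (v ^ (l + 1) * (1 + (n * v) ^ r))) := by
              gcongr
              have : 0 ≤ 2 / c := by positivity
              linarith
      · calc |(lobattoPoly ℝ n).eval x| / (D ^ (l + 1) * N)
            ≤ 2 / (v ^ (l + 1) * (c * (1 * (1 + (n * v) ^ r)))) := by
              gcongr
              · exact abs_lobattoPoly_le_two n hx1
              · refine le_trans ?_ hlo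
                gcongr
          _ = 2 / c * (1 / (v ^ (l + 1) * (1 + (n * v) ^ r))) := by field_simp
          _ ≤ (2 * K + 2 / c) * (1 / (v ^ (l + 1) * (1 + (n * v) ^ r))) := by
              gcongr
              linarith
    · obtain ⟨K, hK, hW⟩ := exists_abs_iterate_derivative_lobattoPoly_le_of_abs_le hδ hδ1 (j + 1)
      refine ⟨2 * K / c, by positivity, fun n x t hn hx ht him => ?_⟩
      have hv : 0 < |t.im| := abs_pos.2 him
      have hlo := hlow n t (by omega) ht
      have hD : |t.im| ≤ ‖(x : ℂ) - t‖ := by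
        simpa using Complex.abs_im_le_norm ((x : ℂ) - t)
      have hW' := hW n x (by omega) hx
      set v := |t.im|
      set D := ‖(x : ℂ) - t‖
      set N := ‖(lobattoPoly ℂ n).eval t‖
      have hn' : (0 : ℝ) < n := by exact_mod_cast (by omega : 0 < n)
      have hu : 0 < n * v := by positivity
      have hD0 : 0 < D := hv.trans_le hD
      have hp := pow_mul_one_add_pow_le hu.le (show j + r ≤ r + (j + 1) by omega)
      calc _ ≤ K * n ^ (j + 1) / (v ^ (l + 1) * (c * (n * v * (1 + (n * v) ^ (r + (j + 1)))))) := by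
            gcongr
        _ = K / c * ((n * v) ^ j / (1 + (n * v) ^ (r + (j + 1)))) * (1 / v ^ (j + 1 + l + 1)) := by
            rw [mul_pow]
            field_simp
            ring
        _ ≤ K / c * (2 / (1 + (n * v) ^ r)) * (1 / v ^ (j + 1 + l + 1)) := by
            gcongr ?_ * ?_ * _
            rw [div_le_div_iff₀ (by positivity) (by positivity)]
            exact hp
        _ = _ := by field_simp
  choose C hC h using key
  refine ⟨∑ i ∈ Finset.range (m + 1), m.choose i * (m - i).factorial * C i (m - i),
    Finset.sum_nonneg fun i _ => mul_nonneg (by positivity) (hC _ _),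
    fun n x t hn hx ht him => norm_iteratedDeriv_interpKernel_le ?_ fun i l hil => ?_⟩
  · rintro rfl
    simp at him
  · subst hil
    exact h i l n x t (by omega) hx ht him

/-- Bound for the derivatives of the kernel at points that stay away from the pole. -/
theorem exists_norm_iteratedDeriv_interpKernel_le_far {ξ : ℝ} (hξ : |ξ| < 1) {d : ℝ}
    (hd : 0 < d) (m r : ℕ) :
    ∃ C, 0 ≤ C ∧ ∀ (n : ℕ) (x : ℝ) (t : ℂ), r + 1 ≤ n → |x| ≤ 1 → d ≤ |x - ξ| → t.re = ξ →
      t.im ≠ 0 → ‖iteratedDeriv m (interpKernel n t) x‖ ≤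
        C * (n ^ (2 * m - 1) / (n * |t.im| * (1 + (n * |t.im|) ^ r))) := by
  have key : ∀ i l : ℕ, ∃ C, 0 ≤ C ∧ ∀ (n : ℕ) (x : ℝ) (t : ℂ), r + 1 ≤ n → |x| ≤ 1 →
      d ≤ |x - ξ| → t.re = ξ → t.im ≠ 0 → |(derivative^[i] (lobattoPoly ℝ n)).eval x| /
      (‖(x : ℂ) - t‖ ^ (l + 1) * ‖(lobattoPoly ℂ n).eval t‖) ≤
        C * (n ^ (2 * (i + l) - 1) / (n * |t.im| * (1 + (n * |t.im|) ^ r))) := by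
    intro i l
    obtain ⟨c, hc, hlow⟩ := exists_le_norm_lobattoPoly_of_re hξ r
    obtain ⟨K, hK, hW⟩ := exists_abs_iterate_derivative_lobattoPoly_le i
    refine ⟨K / (c * d ^ (l + 1)), by positivity, fun n x t hn hx hxd ht him => ?_⟩
    have hv : 0 < |t.im| := abs_pos.2 him
    have hlo := hlow n t hn ht
    have hD : d ≤ ‖(x : ℂ) - t‖ := by
      refine hxd.trans ?_
      simpa [ht] using Complex.abs_re_le_norm ((x : ℂ) - t)
    have hn1 : (1 : ℝ) ≤ n := by exact_mod_cast (by omega : 1 ≤ n)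
    calc _ ≤ K * n ^ (2 * (i + l) - 1) / (d ^ (l + 1) * (c * (n * |t.im| * (1 + (n * |t.im|) ^ r)))) := by
          gcongr
          refine (hW n x (by omega) hx).trans ?_
          have : (n : ℝ) ^ (2 * i - 1) ≤ n ^ (2 * (i + l) - 1) :=
            pow_le_pow_right₀ hn1 (by omega)
          gcongr
      _ = _ := by field_simp
  choose C hC h using key
  refine ⟨∑ i ∈ Finset.range (m + 1), m.choose i * (m - i).factorial * C i (m - i),
    Finset.sum_nonneg fun i _ => mul_nonneg (by positivity) (hC _ _),
    fun n x t hn hx hxd ht him => norm_iteratedDeriv_interpKernel_le ?_ fun i l hil => ?_⟩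
  · rintro rfl
    simp at him
  · subst hil
    exact h i l n x t hn hx hxd ht him

/-- Bound for the derivatives of the kernel with a real pole outside `[-1, 1]`. -/
theorem exists_norm_iteratedDeriv_interpKernel_le_endpoint (m r : ℕ) :
    ∃ C, 0 ≤ C ∧ ∀ (n : ℕ) (x s : ℝ) (t : ℂ), r + 2 * m + 1 ≤ n → |x| ≤ 1 → 0 < s →
      1 + s ≤ ‖t‖ → s ≤ ‖(x : ℂ) - t‖ → 1 - x ^ 2 ≤ 2 * ‖(x : ℂ) - t‖ →
      ‖iteratedDeriv m (interpKernel n t) x‖ ≤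
        C * (1 / (s ^ (m + 1) * (1 + (n * √s) ^ r))) := by
  have key : ∀ i l : ℕ, ∃ C, 0 ≤ C ∧ ∀ (n : ℕ) (x s : ℝ) (t : ℂ), r + 2 * i + 1 ≤ n → |x| ≤ 1 →
      0 < s → 1 + s ≤ ‖t‖ → s ≤ ‖(x : ℂ) - t‖ → 1 - x ^ 2 ≤ 2 * ‖(x : ℂ) - t‖ →
      |(derivative^[i] (lobattoPoly ℝ n)).eval x| /
      (‖(x : ℂ) - t‖ ^ (l + 1) * ‖(lobattoPoly ℂ n).eval t‖) ≤
        C * (1 / (s ^ (i + l + 1) * (1 + (n * √s) ^ r))) := by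
    intro i l
    obtain ⟨c, hc, hlow⟩ := exists_le_norm_lobattoPoly_of_norm (r + 2 * i)
    rcases i with _ | j
    · refine ⟨4 / c, by positivity, fun n x s t hn hx hs ht hD hxD => ?_⟩
      have hlo := hlow n t s (by omega) hs.le ht
      have hn' : (0 : ℝ) < n := by exact_mod_cast (by omega : 0 < n)
      have hW := abs_lobattoPoly_le_mul n hx
      set D := ‖(x : ℂ) - t‖
      have hD0 : 0 < D := hs.trans_le hD
      simp only [Function.iterate_zero, id_eq, zero_add]
      simp only [mul_zero, add_zero] at hlo
      -- Here |W(x)| ≤ 2n(1 - x²) ≤ 4nD cancels both the n in the lower bound and one factor D.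
      calc _ ≤ 2 * n * (2 * D) / (D ^ (l + 1) * (c * (n * s * (1 + (n * √s) ^ r)))) := by
            gcongr
            exact hW.trans (by gcongr)
        _ = 4 / c * (1 / (s * D ^ l * (1 + (n * √s) ^ r))) := by field_simp; ring
        _ ≤ 4 / c * (1 / (s * s ^ l * (1 + (n * √s) ^ r))) := by gcongr
        _ = _ := by rw [pow_succ' s l]
    · obtain ⟨K, hK, hW⟩ := exists_abs_iterate_derivative_lobattoPoly_le (j + 1)
      refine ⟨2 * K / c, by positivity, fun n x s t hn hx hs ht hD _ => ?_⟩
      have hlo := hlow n t s (by omega) hs.le ht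
      have hW' := hW n x (by omega) hx
      have hn' : (0 : ℝ) < n := by exact_mod_cast (by omega : 0 < n)
      have hss : √s ^ 2 = s := Real.sq_sqrt hs.le
      have hq : 0 < √s := Real.sqrt_pos.2 hs
      have hp := pow_mul_one_add_pow_le (by positivity : 0 ≤ n * √s)
        (show 2 * j + r ≤ r + 2 * (j + 1) by omega)
      rw [show 2 * (j + 1) - 1 = 2 * j + 1 by omega] at hW'
      calc _ ≤ K * n ^ (2 * j + 1) /
            (s ^ (l + 1) * (c * (n * s * (1 + (n * √s) ^ (r + 2 * (j + 1)))))) := by gcongr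
        _ = K / c * ((n * √s) ^ (2 * j) / (1 + (n * √s) ^ (r + 2 * (j + 1)))) *
              (1 / s ^ (j + 1 + l + 1)) := by
            rw [mul_pow _ (√s) (2 * j), pow_mul (√s), hss]
            field_simp
            ring
        _ ≤ K / c * (2 / (1 + (n * √s) ^ r)) * (1 / s ^ (j + 1 + l + 1)) := by
            gcongr ?_ * ?_ * _
            rw [div_le_div_iff₀ (by positivity) (by positivity)]
            exact hp
        _ = _ := by field_simp
  choose C hC h using key
  refine ⟨∑ i ∈ Finset.range (m + 1), m.choose i * (m - i).factorial * C i (m - i),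
    Finset.sum_nonneg fun i _ => mul_nonneg (by positivity) (hC _ _),
    fun n x s t hn hx hs ht hD hxD => norm_iteratedDeriv_interpKernel_le ?_ fun i l hil => ?_⟩
  · rintro rfl
    simp at hD
    linarith
  · subst hil
    exact h i l n x s t (by omega) hx hs ht hD hxD

end Kernel

/-! ### Interpolation errors of superpositions and of simple poles. -/

section Interpolation

open Polynomial

/-- The error `f - p_n` of Chebyshev--Lobatto interpolation. -/
noncomputable def interpErr (f : ℝ → ℝ) (n : ℕ) : ℝ → ℝ :=
  fun x => f x - (chebInterpolant f n).eval x

theorem cos_node_mem_Icc (n j : ℕ) : Real.cos (j * Real.pi / n) ∈ Set.Icc (-1 : ℝ) 1 :=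
  ⟨Real.neg_one_le_cos _, Real.cos_le_one _⟩

theorem chebInterpolant_eq_of_eval_eq {f : ℝ → ℝ} {n : ℕ} {q : ℝ[X]} (hq : q.natDegree ≤ n)
    (h : ∀ j : ℕ, q.eval (Real.cos (j * Real.pi / n)) = f (Real.cos (j * Real.pi / n))) :
    chebInterpolant f n = q := by
  refine (Lagrange.eq_interpolate_of_eval_eq _ (Chebyshev.strictAntiOn_node n).injOn ?_
    fun i _ => h i).symm
  rw [Finset.card_range]
  exact (degree_le_of_natDegree_le hq).trans_lt (by exact_mod_cast Nat.lt_succ_self n)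

theorem eval_chebInterpolant (f : ℝ → ℝ) (n : ℕ) (x : ℝ) :
    (chebInterpolant f n).eval x = ∑ j ∈ Finset.range (n + 1), f (Real.cos (j * Real.pi / n)) *
      (Lagrange.basis (Finset.range (n + 1)) (fun j : ℕ => Real.cos (j * Real.pi / n)) j).eval x := by
  simp [chebInterpolant, Lagrange.interpolate_apply, eval_finsetSum]

theorem interpErr_eq_of_eq_add {f e : ℝ → ℝ} {n : ℕ} {q : ℝ[X]} (hq : q.natDegree ≤ n)
    (hf : ∀ x ∈ Set.Icc (-1 : ℝ) 1, f x = e x + q.eval x)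
    (he : ∀ j : ℕ, e (Real.cos (j * Real.pi / n)) = 0) {x : ℝ} (hx : x ∈ Set.Icc (-1 : ℝ) 1) :
    interpErr f n x = e x := by
  rw [interpErr, chebInterpolant_eq_of_eval_eq hq, hf x hx, add_sub_cancel_right]
  intro j
  rw [hf _ (cos_node_mem_Icc n j), he, zero_add]

theorem chebInterpolant_add (f g : ℝ → ℝ) (n : ℕ) :
    chebInterpolant (f + g) n = chebInterpolant f n + chebInterpolant g n := by
  rw [chebInterpolant, chebInterpolant, chebInterpolant, ← map_add]
  rfl

theorem chebInterpolant_const_smul (c : ℝ) (f : ℝ → ℝ) (n : ℕ) :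
    chebInterpolant (c • f) n = c • chebInterpolant f n := by
  rw [chebInterpolant, chebInterpolant, ← map_smul]
  rfl

/-- The interpolant is a finite combination of point values, so it commutes with the integral. -/
theorem interpErr_integral {α : Type*} [MeasurableSpace α] {μ : MeasureTheory.Measure α}
    {f : ℝ → ℝ} {A : α → ℝ → ℝ}
    (hA : ∀ x ∈ Set.Icc (-1 : ℝ) 1, MeasureTheory.Integrable (fun a => A a x) μ)
    (hf : ∀ x ∈ Set.Icc (-1 : ℝ) 1, f x = ∫ a, A a x ∂μ) (n : ℕ) {x : ℝ}
    (hx : x ∈ Set.Icc (-1 : ℝ) 1) :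
    interpErr f n x = ∫ a, interpErr (A a) n x ∂μ := by
  simp only [interpErr, eval_chebInterpolant]
  have h1 : ∀ j ∈ Finset.range (n + 1), MeasureTheory.Integrable (fun a =>
      A a (Real.cos (j * Real.pi / n)) *
      (Lagrange.basis (Finset.range (n + 1)) (fun j : ℕ => Real.cos (j * Real.pi / n)) j).eval x) μ :=
    fun j _ => (hA _ (cos_node_mem_Icc n j)).mul_const _
  rw [MeasureTheory.integral_sub (hA x hx) (MeasureTheory.integrable_finsetSum _ h1),
    MeasureTheory.integral_finsetSum _ h1, hf x hx]
  congr 1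
  refine Finset.sum_congr rfl fun j _ => ?_
  rw [MeasureTheory.integral_mul_const, hf _ (cos_node_mem_Icc n j)]

/-- Repeated differentiation under the integral sign; each order j ≤ m needs its own integrable
majorant. -/
theorem iteratedDeriv_integral {α : Type*} [MeasurableSpace α] {μ : MeasureTheory.Measure α}
    {U : Set ℝ} (hU : IsOpen U) {F : ℝ → ℝ} {H : α → ℝ → ℝ} {m : ℕ} {B : ℕ → α → ℝ}
    (hF : ∀ x ∈ U, F x = ∫ a, H a x ∂μ)
    (hH : ∀ᵐ a ∂μ, ∀ x ∈ U, ContDiffAt ℝ m (H a) x)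
    (hmeas : ∀ j ≤ m, ∀ x ∈ U,
      MeasureTheory.AEStronglyMeasurable (fun a => iteratedDeriv j (H a) x) μ)
    (hB : ∀ j ≤ m, ∀ᵐ a ∂μ, ∀ x ∈ U, |iteratedDeriv j (H a) x| ≤ B j a)
    (hBint : ∀ j ≤ m, MeasureTheory.Integrable (B j) μ) :
    ∀ j ≤ m, ∀ x ∈ U, iteratedDeriv j F x = ∫ a, iteratedDeriv j (H a) x ∂μ := by
  intro j
  induction j with
  | zero => intro _ x hx; simpa using hF x hx
  | succ j ih =>
    intro hj x hx
    have hev : iteratedDeriv j F =ᶠ[nhds x] fun y => ∫ a, iteratedDeriv j (H a) y ∂μ := by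
      filter_upwards [hU.mem_nhds hx] with y hy using ih (by omega) y hy
    rw [iteratedDeriv_succ, hev.deriv_eq]
    have hint : MeasureTheory.Integrable (fun a => iteratedDeriv j (H a) x) μ :=
      (hBint j (by omega)).mono' (hmeas j (by omega) x hx) (by
        filter_upwards [hB j (by omega)] with a ha using ha x hx)
    refine (hasDerivAt_integral_of_dominated_loc_of_deriv_le (hU.mem_nhds hx)
      (F' := fun y a => iteratedDeriv (j + 1) (H a) y) ?_ hint (hmeas (j + 1) hj x hx)
      (hB (j + 1) hj) (hBint (j + 1) hj) ?_).2.deriv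
    · filter_upwards [hU.mem_nhds hx] with y hy using hmeas j (by omega) y hy
    · filter_upwards [hH] with a ha y hy
      rw [iteratedDeriv_succ]
      refine DifferentiableAt.hasDerivAt ?_
      rw [← differentiableWithinAt_univ, ← iteratedDerivWithin_univ]
      exact (ha y hy).contDiffWithinAt.differentiableWithinAt_iteratedDerivWithin
        (by exact_mod_cast hj) (by simp)

theorem iteratedDeriv_eval (p : ℝ[X]) (k : ℕ) :
    iteratedDeriv k (fun x => p.eval x) = fun x => (derivative^[k] p).eval x := by
  induction k with
  | zero => simp
  | succ k ih =>
    rw [iteratedDeriv_succ, ih]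
    funext x
    rw [Function.iterate_succ_apply', Polynomial.deriv]

theorem chebDiffError_eq_iteratedDeriv {f : ℝ → ℝ} {m : ℕ}
    (hf : ContDiffOn ℝ m f (Set.Icc (-1) 1)) (n : ℕ) {x : ℝ} (hx : x ∈ Set.Ioo (-1 : ℝ) 1) :
    chebDiffError f m n x = iteratedDeriv m (interpErr f n) x := by
  have hfx : ContDiffAt ℝ m f x := hf.contDiffAt (Icc_mem_nhds hx.1 hx.2)
  have hp : ContDiffAt ℝ m (fun x => (chebInterpolant f n).eval x) x := by
    have h : ContDiff ℝ m (fun x : ℝ => (chebInterpolant f n).eval x) := by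
      simpa only [Polynomial.coe_aeval_eq_eval] using
        (chebInterpolant f n).contDiff_aeval (𝕜 := ℝ) m
    exact h.contDiffAt
  rw [chebDiffError, iteratedDerivWithin_eq_iteratedDeriv (uniqueDiffOn_Icc (by norm_num)) hfx
    (Set.Ioo_subset_Icc_self hx)]
  unfold interpErr
  rw [iteratedDeriv_fun_sub hfx hp, iteratedDeriv_eval (chebInterpolant f n) m]

/-- If `f` is a superposition of functions `A a`, then the error of `f` is bounded by the
integral of bounds for the errors of the functions `A a`. -/
theorem abs_chebDiffError_le_integral {α : Type*} [MeasurableSpace α]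
    {μ : MeasureTheory.Measure α} {U : Set ℝ} (hU : IsOpen U) (hU1 : U ⊆ Set.Ioo (-1) 1)
    {f : ℝ → ℝ} {A H : α → ℝ → ℝ} {m n : ℕ} {B : ℕ → α → ℝ}
    (hfm : ContDiffOn ℝ m f (Set.Icc (-1) 1))
    (hA : ∀ x ∈ Set.Icc (-1 : ℝ) 1, MeasureTheory.Integrable (fun a => A a x) μ)
    (hf : ∀ x ∈ Set.Icc (-1 : ℝ) 1, f x = ∫ a, A a x ∂μ)
    (hAH : ∀ᵐ a ∂μ, ∀ x ∈ Set.Icc (-1 : ℝ) 1, interpErr (A a) n x = H a x)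
    (hH : ∀ᵐ a ∂μ, ∀ x ∈ U, ContDiffAt ℝ m (H a) x)
    (hmeas : ∀ j ≤ m, ∀ x ∈ U,
      MeasureTheory.AEStronglyMeasurable (fun a => iteratedDeriv j (H a) x) μ)
    (hB : ∀ j ≤ m, ∀ᵐ a ∂μ, ∀ x ∈ U, |iteratedDeriv j (H a) x| ≤ B j a)
    (hBint : ∀ j ≤ m, MeasureTheory.Integrable (B j) μ) {x : ℝ} (hx : x ∈ U) :
    |chebDiffError f m n x| ≤ ∫ a, B m a ∂μ := by
  rw [chebDiffError_eq_iteratedDeriv hfm n (hU1 hx), iteratedDeriv_integral hU (F := interpErr f n)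
    ?_ hH hmeas hB hBint m le_rfl x hx]
  · rw [← Real.norm_eq_abs]
    refine MeasureTheory.norm_integral_le_of_norm_le (hBint m le_rfl) ?_
    filter_upwards [hB m le_rfl] with a ha using ha x hx
  · intro y hy
    have hy' := Set.Ioo_subset_Icc_self (hU1 hy)
    rw [interpErr_integral hA hf n hy']
    refine MeasureTheory.integral_congr_ae ?_
    filter_upwards [hAH] with a ha using ha y hy'

/-- Interpolation error of a rational function with a single simple pole. -/
theorem interpErr_re_mul_div {n M : ℕ} (hn : 1 ≤ n) (hM : M ≤ n + 1) (ξ : ℝ) (c t : ℂ)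
    (ht : ∀ x ∈ Set.Icc (-1 : ℝ) 1, (x : ℂ) ≠ t) (hW : (lobattoPoly ℂ n).eval t ≠ 0)
    {x : ℝ} (hx : x ∈ Set.Icc (-1 : ℝ) 1) :
    interpErr (fun y : ℝ => (c * (((y : ℂ) - ξ) ^ M / ((y : ℂ) - t))).re) n x =
      (c * (t - ξ) ^ M * interpKernel n t x).re := by
  set w := (lobattoPoly ℂ n).eval t with hw
  -- P vanishes at t, so P = (X - t) R with deg R ≤ n. Dividing by w (x - t) shows that R/w is the
  -- interpolant of (x - ξ)^M / (x - t), the difference being a multiple of W.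
  set P : ℂ[X] := (X - Polynomial.C (ξ : ℂ)) ^ M * Polynomial.C w -
    Polynomial.C ((t - ξ) ^ M) * lobattoPoly ℂ n with hP
  have hroot : P.IsRoot t := by simp [hP, IsRoot, ← hw]
  obtain ⟨R, hR⟩ := dvd_iff_isRoot.2 hroot
  have hPdeg : P.natDegree ≤ n + 1 := by
    refine (natDegree_sub_le _ _).trans (max_le ?_ ?_)
    · refine (natDegree_mul_C_le _ _).trans ((natDegree_pow_le).trans ?_)
      simpa using hM
    · exact (natDegree_C_mul_le _ _).trans (natDegree_lobattoPoly_le hn)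
  have hRdeg : R.natDegree ≤ n := by
    by_cases hR0 : R = 0
    · simp [hR0]
    rw [hR, natDegree_mul (X_sub_C_ne_zero t) hR0, natDegree_X_sub_C] at hPdeg
    omega
  set Q : ℂ[X] := Polynomial.C (c * w⁻¹) * R with hQ
  have hQdeg : Q.natDegree ≤ n := (natDegree_C_mul_le _ _).trans hRdeg
  -- Real parts of the coefficients give a real polynomial equal to Re Q on the real line.
  set q : ℝ[X] := ∑ i ∈ Finset.range (n + 1), Polynomial.C (Q.coeff i).re * X ^ i with hq
  have hqdeg : q.natDegree ≤ n := by
    refine natDegree_sum_le_of_forall_le _ _ fun i hi => (natDegree_C_mul_X_pow_le _ _).trans ?_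
    have := Finset.mem_range.1 hi
    omega
  have hqev : ∀ y : ℝ, q.eval y = (Q.eval (y : ℂ)).re := by
    intro y
    rw [eval_eq_sum_range' (Nat.lt_succ_of_le hQdeg), Complex.re_sum, hq, eval_finsetSum]
    refine Finset.sum_congr rfl fun i _ => ?_
    rw [← Complex.ofReal_pow, Complex.re_mul_ofReal]
    simp
  refine interpErr_eq_of_eq_add (e := fun y => (c * (t - ξ) ^ M * interpKernel n t y).re) hqdeg ?_ ?_ hx
  · intro y hy
    have hy0 : (y : ℂ) - t ≠ 0 := sub_ne_zero.2 (ht y hy)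
    rw [hqev, ← Complex.add_re]
    congr 1
    have hev := congrArg (eval (y : ℂ)) hR
    simp only [hP, eval_sub, eval_mul, eval_pow, eval_X, eval_C, lobattoPoly_eval_ofReal] at hev
    rw [interpKernel, ← hw, hQ, eval_mul, eval_C]
    field_simp
    linear_combination c * hev
  · intro j
    simp [interpKernel, lobattoPoly_eval_node hn]

theorem iteratedDeriv_re_const_mul {f : ℝ → ℂ} {m : ℕ} {x : ℝ} (hf : ContDiffAt ℝ m f x) (c : ℂ) :
    iteratedDeriv m (fun y => (c * f y).re) x = (c * iteratedDeriv m f x).re := by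
  have hc : ContDiffAt ℝ m (fun y => c * f y) x := contDiffAt_const.mul hf
  have h := Complex.reCLM.iteratedFDeriv_comp_left hc (i := m) le_rfl
  have h2 : iteratedDeriv m (fun y => (c * f y).re) x =
      (iteratedDeriv m (fun y => c * f y) x).re := by
    rw [iteratedDeriv, iteratedDeriv]
    exact congrArg (fun L => L fun _ => 1) h
  rw [h2, iteratedDeriv_const_mul_field]

end Interpolation

/-! ### Smoothness of |x - ξ|^p. -/

section Smoothness

theorem hasDerivAt_mul_abs_rpow (x : ℝ) {p : ℝ} (hp : 0 < p) :
    HasDerivAt (fun x : ℝ => x * |x| ^ p) ((p + 1) * |x| ^ p) x := by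
  rcases eq_or_ne x 0 with rfl | hx
  · rw [hasDerivAt_iff_tendsto_slope]
    have h1 : Tendsto (fun y : ℝ => |y| ^ p) (nhdsWithin 0 {0}ᶜ) (nhds ((p + 1) * |(0 : ℝ)| ^ p)) := by
      have h2 : ContinuousAt (fun y : ℝ => |y| ^ p) 0 :=
        continuous_abs.continuousAt.rpow_const (Or.inr hp.le)
      have h3 := h2.tendsto.mono_left (nhdsWithin_le_nhds (s := {0}ᶜ))
      simpa [Real.zero_rpow hp.ne'] using h3
    refine h1.congr' ?_
    filter_upwards [self_mem_nhdsWithin] with y hy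
    have hy' : y ≠ 0 := hy
    simp [slope_def_field]
    field_simp
  · have h1 : HasDerivAt (fun x : ℝ => |x| ^ p) (p * |x| ^ (p - 2) * x) x := by
      rcases lt_or_gt_of_ne hx with h | h
      · have h2 := ((hasDerivAt_neg x).rpow_const (p := p) (Or.inl (neg_ne_zero.2 hx)))
        have hev : (fun x : ℝ => |x| ^ p) =ᶠ[nhds x] fun x => (-x) ^ p := by
          filter_upwards [Iio_mem_nhds h] with y hy
          rw [abs_of_neg hy]
        refine (h2.congr_of_eventuallyEq hev).congr_deriv ?_
        rw [abs_of_neg h, show p - 1 = p - 2 + 1 by ring, Real.rpow_add_one (by linarith)]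
        ring
      · have h2 := ((hasDerivAt_id x).rpow_const (p := p) (Or.inl hx))
        have hev : (fun x : ℝ => |x| ^ p) =ᶠ[nhds x] fun x => x ^ p := by
          filter_upwards [Ioi_mem_nhds h] with y hy
          rw [abs_of_pos hy]
        refine (h2.congr_of_eventuallyEq hev).congr_deriv ?_
        rw [abs_of_pos h, show p - 1 = p - 2 + 1 by ring, Real.rpow_add_one (by simpa using hx)]
        simp
        ring
    refine ((hasDerivAt_id x).mul h1).congr_deriv ?_
    have h0 : |x| ^ p = |x| ^ (p - 2) * x ^ 2 := by
      rw [← sq_abs x, ← Real.rpow_natCast |x| 2, ← Real.rpow_add (abs_pos.2 hx)]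
      norm_num
    simp only [id_eq, h0]
    ring

/-- The derivative of |x|^p is p x|x|^(p-2), and that of x|x|^(p-1) is p |x|^(p-1). The two families
exchange under differentiation, so the induction carries both. -/
theorem contDiff_abs_rpow_and (m : ℕ) :
    ∀ p : ℝ, (m : ℝ) < p → ContDiff ℝ m (fun x : ℝ => |x| ^ p) ∧
      ContDiff ℝ m (fun x : ℝ => x * |x| ^ (p - 1)) := by
  induction m with
  | zero =>
    intro p hp
    simp only [Nat.cast_zero] at hp ⊢
    refine ⟨contDiff_zero.2 (continuous_abs.rpow_const fun _ => Or.inr hp.le), contDiff_zero.2 ?_⟩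
    -- The exponent p - 1 may be negative, so continuity at 0 is read off from sign(x) |x|^p.
    have hc : Continuous fun x : ℝ => SignType.sign x * |x| ^ p := by
      rw [continuous_iff_continuousAt]
      intro x
      rcases eq_or_ne x 0 with rfl | hx
      · rw [ContinuousAt]
        simp only [abs_zero, Real.zero_rpow hp.ne', mul_zero]
        have h1 : Tendsto (fun x : ℝ => |x| ^ p) (nhds 0) (nhds 0) := by
          have := (continuous_abs.rpow_const (p := p) fun _ => Or.inr hp.le).tendsto (0 : ℝ)
          simpa [Real.zero_rpow hp.ne'] using this
        refine squeeze_zero_norm (fun y => ?_) h1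
        rw [norm_mul, Real.norm_of_nonneg (by positivity : 0 ≤ |y| ^ p)]
        refine mul_le_of_le_one_left (by positivity) ?_
        rcases lt_trichotomy y 0 with h | h | h <;> simp [h]
      · refine ContinuousAt.mul ?_ (continuous_abs.continuousAt.rpow_const (Or.inr hp.le))
        rcases lt_or_gt_of_ne hx with h | h
        · refine (continuousAt_const (y := (-1 : ℝ))).congr ?_
          filter_upwards [Iio_mem_nhds h] with y hy
          have hy' : y < 0 := hy
          simp [hy']
        · refine (continuousAt_const (y := (1 : ℝ))).congr ?_
          filter_upwards [Ioi_mem_nhds h] with y hy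
          have hy' : 0 < y := hy
          simp [hy']
    refine hc.congr fun x => ?_
    rcases eq_or_ne x 0 with rfl | hx
    · simp
    · rw [show p = p - 1 + 1 by ring, Real.rpow_add_one (abs_ne_zero.2 hx)]
      simp only [add_sub_cancel_right]
      rw [mul_comm (|x| ^ (p - 1)), ← mul_assoc, sign_mul_abs]
  | succ m ih =>
    intro p hp
    push_cast at hp ⊢
    have hm : (0 : ℝ) ≤ m := m.cast_nonneg
    have hd1 : ∀ x : ℝ, HasDerivAt (fun x : ℝ => |x| ^ p) (p * |x| ^ (p - 2) * x) x :=
      fun x => hasDerivAt_abs_rpow x (by linarith)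
    have hd2 : ∀ x : ℝ, HasDerivAt (fun x : ℝ => x * |x| ^ (p - 1)) ((p - 1 + 1) * |x| ^ (p - 1)) x :=
      fun x => hasDerivAt_mul_abs_rpow x (by linarith)
    obtain ⟨h1, h2⟩ := ih (p - 1) (by linarith)
    constructor
    · refine contDiff_succ_iff_deriv.2 ⟨fun x => (hd1 x).differentiableAt, by simp, ?_⟩
      rw [funext fun x => (hd1 x).deriv]
      have h3 := (contDiff_const (c := p)).mul h2
      rw [show p - 1 - 1 = p - 2 by ring] at h3
      simpa only [mul_comm, mul_left_comm, mul_assoc] using h3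
    · refine contDiff_succ_iff_deriv.2 ⟨fun x => (hd2 x).differentiableAt, by simp, ?_⟩
      rw [funext fun x => (hd2 x).deriv]
      exact contDiff_const.mul h1

theorem contDiff_abs_sub_rpow {m : ℕ} {p : ℝ} (hp : (m : ℝ) < p) (ξ : ℝ) :
    ContDiff ℝ m (fun x : ℝ => |x - ξ| ^ p) :=
  (contDiff_abs_rpow_and m p hp).1.comp (contDiff_id.sub contDiff_const)

end Smoothness

/-! ### Weight integrals in s and the representation of powers. -/

section WeightIntegrals

open MeasureTheory Set

/-- The integral `∫ s^b / (1 + s^{r/2}) ds` over `(0, ∞)`. -/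
noncomputable def decayIntegral (b : ℝ) (r : ℕ) : ℝ :=
  ∫ s in Ioi (0 : ℝ), s ^ b / (1 + √s ^ r)

theorem decayIntegral_nonneg (b : ℝ) (r : ℕ) : 0 ≤ decayIntegral b r :=
  setIntegral_nonneg measurableSet_Ioi fun s hs => by
    have : (0 : ℝ) < s := hs
    positivity

/-- The condition b > -1 gives integrability at 0, and b - r/2 < -1 gives it at infinity. -/
theorem integrableOn_rpow_div_one_add_pow {b : ℝ} {r : ℕ} (hb : -1 < b) (hr : 2 * b + 2 < r) :
    IntegrableOn (fun s : ℝ => s ^ b / (1 + √s ^ r)) (Ioi 0) := by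
  have hm : Measurable fun s : ℝ => s ^ b / (1 + √s ^ r) := by fun_prop
  rw [← Ioc_union_Ioi_eq_Ioi zero_le_one]
  refine IntegrableOn.union ?_ ?_
  · have h := (intervalIntegral.intervalIntegrable_rpow' hb (a := 0) (b := 1)).1
    refine h.mono' hm.aestronglyMeasurable ?_
    filter_upwards [ae_restrict_mem measurableSet_Ioc] with s hs
    have hs0 : 0 < s := hs.1
    rw [Real.norm_of_nonneg (by positivity)]
    refine div_le_self (by positivity) ?_
    have : 0 ≤ √s ^ r := by positivity
    linarith
  · have h := integrableOn_Ioi_rpow_of_lt (a := b - r / 2) (by linarith) zero_lt_one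
    refine h.mono' hm.aestronglyMeasurable ?_
    filter_upwards [ae_restrict_mem measurableSet_Ioi] with s hs
    have hs0 : 0 < s := zero_lt_one.trans hs
    rw [Real.norm_of_nonneg (by positivity), Real.rpow_sub hs0]
    have h1 : √s ^ r = s ^ ((r : ℝ) / 2) := by
      rw [Real.sqrt_eq_rpow, ← Real.rpow_natCast, ← Real.rpow_mul hs0.le]
      ring_nf
    rw [h1]
    gcongr
    linarith

/-- Homogeneity under s ↦ n²s, the source of the factor n^(-2b-2) in the integrated bounds. -/
theorem rpow_div_one_add_mul_pow_eq (b : ℝ) (r : ℕ) {n : ℕ} (hn : 1 ≤ n) {s : ℝ} (hs : 0 < s) :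
    s ^ b / (1 + (n * √s) ^ r) =
      (n : ℝ) ^ (-2 * b) * ((n ^ 2 * s) ^ b / (1 + √(n ^ 2 * s) ^ r)) := by
  have hn' : (0 : ℝ) < n := by exact_mod_cast hn
  rw [Real.sqrt_mul (by positivity), Real.sqrt_sq hn'.le, Real.mul_rpow (by positivity) hs.le,
    ← mul_div_assoc, ← mul_assoc, ← Real.rpow_natCast (n : ℝ) 2, ← Real.rpow_mul hn'.le,
    ← Real.rpow_add hn']
  simp

theorem integrableOn_rpow_div_one_add_mul_pow {b : ℝ} {r : ℕ} (hb : -1 < b) (hr : 2 * b + 2 < r)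
    {n : ℕ} (hn : 1 ≤ n) : IntegrableOn (fun s : ℝ => s ^ b / (1 + (n * √s) ^ r)) (Ioi 0) := by
  have hn' : (0 : ℝ) < (n : ℝ) ^ 2 := by positivity
  have h := (integrableOn_Ioi_comp_mul_left_iff (fun s : ℝ => s ^ b / (1 + √s ^ r)) 0 hn').2
    (by simpa using integrableOn_rpow_div_one_add_pow hb hr)
  refine IntegrableOn.congr_fun (h.const_mul ((n : ℝ) ^ (-2 * b))) (fun s hs => ?_) measurableSet_Ioi
  exact (rpow_div_one_add_mul_pow_eq b r hn hs).symm

theorem integral_rpow_div_one_add_mul_pow (b : ℝ) (r : ℕ) {n : ℕ} (hn : 1 ≤ n) :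
    ∫ s in Ioi (0 : ℝ), s ^ b / (1 + (n * √s) ^ r) =
      decayIntegral b r * (n : ℝ) ^ (-2 * b - 2) := by
  have hn0 : (0 : ℝ) < n := by exact_mod_cast hn
  have hn' : (0 : ℝ) < (n : ℝ) ^ 2 := by positivity
  rw [setIntegral_congr_fun measurableSet_Ioi fun s hs => rpow_div_one_add_mul_pow_eq b r hn hs,
    integral_const_mul, integral_comp_mul_left_Ioi (fun s : ℝ => s ^ b / (1 + √s ^ r)) 0 hn',
    mul_zero, decayIntegral, smul_eq_mul, Real.rpow_sub hn0]
  norm_cast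
  ring

/-- Integral representation of a noninteger power. -/
theorem exists_rpow_eq_integral {α : ℝ} (hα : 0 < α) (hint : ∀ k : ℤ, α ≠ k) :
    ∃ (k : ℕ) (p c : ℝ), α = k + p ∧ 0 < c ∧ ∀ y : ℝ, 0 ≤ y →
      IntegrableOn (fun s => c * s ^ (p - 1) * (y ^ (k + 1) / (s + y))) (Ioi 0) ∧
      y ^ α = ∫ s in Ioi (0 : ℝ), c * s ^ (p - 1) * (y ^ (k + 1) / (s + y)) := by
  set k := ⌊α⌋₊
  have hk : (k : ℝ) ≤ α := Nat.floor_le hα.le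
  have hk1 : α < k + 1 := Nat.lt_floor_add_one α
  have hk2 : (k : ℝ) ≠ α := fun h => hint k (by rw [← h]; simp)
  have hp : α - k ∈ Ioo (0 : ℝ) 1 := ⟨sub_pos.2 (lt_of_le_of_ne hk hk2), by linarith⟩
  set p := α - k with hpdef
  set C := ∫ t in Ioi (0 : ℝ), Real.rpowIntegrand₀₁ p t 1
  -- A known lower bound 1 / (2(1 - p)) for the normalising integral is positive since p < 1.
  have hC : 0 < C := lt_of_lt_of_le
    (by rw [show -1 / (2 * (p - 1)) = 1 / (2 * (1 - p)) by
          have : p - 1 ≠ 0 := by linarith [hp.2]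
          have : 1 - p ≠ 0 := by linarith [hp.2]
          field_simp
          ring]
        have := hp.2
        have : 0 < 1 - p := by linarith
        positivity) (Real.le_integral_rpowIntegrand₀₁_one hp)
  refine ⟨k, p, C⁻¹, by rw [hpdef]; ring, by positivity, fun y hy => ?_⟩
  have heq : EqOn (fun s => C⁻¹ * y ^ k * Real.rpowIntegrand₀₁ p s y)
      (fun s => C⁻¹ * s ^ (p - 1) * (y ^ (k + 1) / (s + y))) (Ioi 0) := fun s hs => by
    have hs' : (0 : ℝ) < s := hs
    simp only
    rw [Real.rpowIntegrand₀₁_eq_pow_div hp hs'.le hy]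
    ring
  refine ⟨IntegrableOn.congr_fun
    ((Real.integrableOn_rpowIntegrand₀₁_Ioi hp hy).const_mul _) heq measurableSet_Ioi, ?_⟩
  rw [← setIntegral_congr_fun measurableSet_Ioi heq, integral_const_mul,
    Real.integral_rpowIntegrand₀₁_eq_rpow_mul_const hp hy]
  have : y ^ α = y ^ k * y ^ p := by
    rw [← Real.rpow_natCast, ← Real.rpow_add_of_nonneg hy k.cast_nonneg hp.1.le]
    rw [hpdef]; ring_nf
  rw [this]
  change _ = C⁻¹ * y ^ k * (y ^ p * C)
  field_simp

end WeightIntegrals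

/-! ### Error bounds for integrals over poles. -/

section PoleSuperposition

open MeasureTheory Set

theorem aestronglyMeasurable_iteratedDeriv_interpKernel {c t : ℝ → ℂ} (hc : Measurable c)
    (ht : Measurable t) (n j : ℕ) {x : ℝ} (hne : ∀ s, 0 < s → (x : ℂ) ≠ t s) :
    AEStronglyMeasurable (fun s => iteratedDeriv j (fun y => (c s * interpKernel n (t s) y).re) x)
      (volume.restrict (Ioi 0)) := by
  have hW : Measurable fun s => (lobattoPoly ℂ n).eval (t s) :=
    (lobattoPoly ℂ n).continuous.measurable.comp ht
  have hm : Measurable fun s => (c s * ((∑ i ∈ Finset.range (j + 1), (j.choose i : ℂ) *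
        (((Polynomial.derivative^[i] (lobattoPoly ℝ n)).eval x : ℝ) : ℂ) *
        ((-1) ^ (j - i) * (j - i).factorial * (((x : ℂ) - t s) ^ (j - i + 1))⁻¹)) *
        ((lobattoPoly ℂ n).eval (t s))⁻¹)).re := by
    fun_prop
  refine hm.aestronglyMeasurable.congr ?_
  filter_upwards [ae_restrict_mem measurableSet_Ioi] with s hs
  rw [iteratedDeriv_re_const_mul (contDiffAt_interpKernel n (t s) j (hne s hs)),
    iteratedDeriv_interpKernel n j (t s) (hne s hs)]

/-- Error bound for a superposition of rational functions with poles off `[-1, 1]`. -/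
theorem abs_chebDiffError_le_of_poles {ξ : ℝ} {f : ℝ → ℝ} {c t : ℝ → ℂ} {m n M r : ℕ}
    {D b : ℕ → ℝ} {U : Set ℝ} (hc : Measurable c) (ht : Measurable t) (hn : 1 ≤ n)
    (hM : M ≤ n + 1) (hU : IsOpen U) (hU1 : U ⊆ Ioo (-1) 1)
    (hfm : ContDiffOn ℝ m f (Icc (-1) 1))
    (hne : ∀ s, 0 < s → ∀ x ∈ Icc (-1 : ℝ) 1, (x : ℂ) ≠ t s)
    (hW : ∀ s, 0 < s → (lobattoPoly ℂ n).eval (t s) ≠ 0)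
    (hint : ∀ x ∈ Icc (-1 : ℝ) 1,
      IntegrableOn (fun s => (c s * (((x : ℂ) - ξ) ^ M / ((x : ℂ) - t s))).re) (Ioi 0))
    (hf : ∀ x ∈ Icc (-1 : ℝ) 1,
      f x = ∫ s in Ioi (0 : ℝ), (c s * (((x : ℂ) - ξ) ^ M / ((x : ℂ) - t s))).re)
    (hb : ∀ j ≤ m, -1 < b j) (hr : ∀ j ≤ m, 2 * b j + 2 < r)
    (hB : ∀ j ≤ m, ∀ s, 0 < s → ∀ x ∈ U,
      ‖c s * (t s - ξ) ^ M‖ * ‖iteratedDeriv j (interpKernel n (t s)) x‖ ≤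
        D j * (s ^ b j / (1 + (n * √s) ^ r))) :
    ∀ x ∈ U, |chebDiffError f m n x| ≤ D m * (decayIntegral (b m) r * (n : ℝ) ^ (-2 * b m - 2)) := by
  intro x hx
  have hne' : ∀ x ∈ U, ∀ s, 0 < s → (x : ℂ) ≠ t s :=
    fun x hx s hs => hne s hs x (Ioo_subset_Icc_self (hU1 hx))
  have h := abs_chebDiffError_le_integral (μ := volume.restrict (Ioi (0 : ℝ))) (n := n) hU hU1 hfm
    (A := fun s x => (c s * (((x : ℂ) - ξ) ^ M / ((x : ℂ) - t s))).re)
    (H := fun s x => (c s * (t s - ξ) ^ M * interpKernel n (t s) x).re)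
    (B := fun j s => D j * (s ^ b j / (1 + (n * √s) ^ r))) hint hf ?_ ?_ ?_ ?_ ?_ hx
  · rwa [integral_const_mul, integral_rpow_div_one_add_mul_pow _ _ hn] at h
  · filter_upwards [ae_restrict_mem measurableSet_Ioi] with s hs y hy
    exact interpErr_re_mul_div hn hM ξ (c s) (t s) (hne s hs) (hW s hs) hy
  · filter_upwards [ae_restrict_mem measurableSet_Ioi] with s hs y hy
    exact Complex.reCLM.contDiff.contDiffAt.comp y
      (contDiffAt_const.mul (contDiffAt_interpKernel n (t s) m (hne' y hy s hs)))
  · intro j _ y hy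
    exact aestronglyMeasurable_iteratedDeriv_interpKernel
      (hc.mul ((ht.sub measurable_const).pow_const M)) ht n j (hne' y hy)
  · intro j hj
    filter_upwards [ae_restrict_mem measurableSet_Ioi] with s hs y hy
    rw [iteratedDeriv_re_const_mul (contDiffAt_interpKernel n (t s) j (hne' y hy s hs))]
    refine (Complex.abs_re_le_norm _).trans ?_
    rw [norm_mul]
    exact hB j hj s hs y hy
  · intro j hj
    exact (integrableOn_rpow_div_one_add_mul_pow (hb j hj) (hr j hj) hn).const_mul _

end PoleSuperposition

/-! ### Pure powers with an interior or endpoint singularity. -/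

section PowerFunctions

open MeasureTheory Set

/-- The `m`-th derivative of the interpolation error of `f` is `O(n^e)`, uniformly on `(-1, 1)`. -/
def HasInterpRate (f : ℝ → ℝ) (m : ℕ) (e : ℝ) : Prop :=
  ∃ C : ℝ, ∀ᶠ n : ℕ in atTop, ∀ x ∈ Ioo (-1 : ℝ) 1, |chebDiffError f m n x| ≤ C * (n : ℝ) ^ e

theorem contDiff_abs_rpow_mul_pow {σ : ℝ} {m : ℕ} (hm : (m : ℝ) < σ) (ξ : ℝ) (j : ℕ) :
    ContDiff ℝ m (fun x : ℝ => |x - ξ| ^ σ * (x - ξ) ^ j) :=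
  (contDiff_abs_sub_rpow hm ξ).mul ((contDiff_id.sub contDiff_const).pow j)

/-- With u = x - ξ, 1 / (s + u²) is Im(1 / (u - i√s)) / √s. The factor -i turns the imaginary part
into a real part, and the division by √s lowers the exponent p - 1 to p - 3/2; one pole suffices
instead of a conjugate pair. -/
theorem interior_pole_identity (ξ x : ℝ) (k j : ℕ) (p C : ℝ) {s : ℝ} (hs : 0 < s) :
    ((-Complex.I * ((C * s ^ (p - 3 / 2) : ℝ) : ℂ)) *
      (((x : ℂ) - ξ) ^ (2 * k + 2 + j) / ((x : ℂ) - (ξ + √s * Complex.I)))).re =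
    (x - ξ) ^ j * (C * s ^ (p - 1) * (((x - ξ) ^ 2) ^ (k + 1) / (s + (x - ξ) ^ 2))) := by
  have hq : 0 < √s := Real.sqrt_pos.2 hs
  have hss : √s ^ 2 = s := Real.sq_sqrt hs.le
  have h1 : s ^ (p - 1) = s ^ (p - 3 / 2) * √s := by
    rw [Real.sqrt_eq_rpow, ← Real.rpow_add hs]
    congr 1
    ring
  have hy : 0 < s + (x - ξ) ^ 2 := by positivity
  have hinv : ((x : ℂ) - (ξ + √s * Complex.I))⁻¹ =
      (((x - ξ) / (s + (x - ξ) ^ 2) : ℝ) : ℂ) + ((√s / (s + (x - ξ) ^ 2) : ℝ) : ℂ) * Complex.I := by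
    refine inv_eq_of_mul_eq_one_right ?_
    have hy' : ((s + (x - ξ) ^ 2 : ℝ) : ℂ) ≠ 0 := by exact_mod_cast hy.ne'
    have hsc : ((√s : ℝ) : ℂ) ^ 2 = (s : ℂ) := by exact_mod_cast hss
    push_cast at hy' ⊢
    field_simp
    linear_combination (-(√s : ℂ) ^ 2) * Complex.I_sq + hsc
  rw [div_eq_mul_inv (((x : ℂ) - ξ) ^ (2 * k + 2 + j)), hinv, h1]
  have e : ((x : ℂ) - ξ) ^ (2 * k + 2 + j) = (((x - ξ) ^ (2 * k + 2 + j) : ℝ) : ℂ) := by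
    push_cast
    rfl
  rw [e]
  set u := (x - ξ) ^ (2 * k + 2 + j) with hu
  have hu' : u = (x - ξ) ^ j * ((x - ξ) ^ 2) ^ (k + 1) := by
    rw [hu, ← pow_mul, ← pow_add]
    ring_nf
  simp only [Complex.mul_re, Complex.mul_im, Complex.add_re, Complex.add_im, Complex.ofReal_re,
    Complex.ofReal_im, Complex.neg_re, Complex.neg_im, Complex.I_re, Complex.I_im]
  rw [hu']
  ring

theorem norm_interior_pole_coeff (ξ : ℝ) (k j : ℕ) (p : ℝ) {C s : ℝ} (hC : 0 < C) (hs : 0 < s) :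
    ‖(-Complex.I * ((C * s ^ (p - 3 / 2) : ℝ) : ℂ)) *
      (((ξ : ℂ) + √s * Complex.I) - ξ) ^ (2 * k + 2 + j)‖ =
      C * s ^ ((2 * (k + p) + j) / 2 - 1 / 2) := by
  rw [add_sub_cancel_left, norm_mul, norm_mul, norm_pow, norm_mul, norm_neg, Complex.norm_I,
    Complex.norm_real, Complex.norm_real, Real.norm_of_nonneg (by positivity),
    Real.norm_of_nonneg (Real.sqrt_nonneg s), mul_one, one_mul, mul_assoc, Real.sqrt_eq_rpow,
    ← Real.rpow_natCast, ← Real.rpow_mul hs.le, ← Real.rpow_add hs]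
  congr 2
  push_cast
  ring

theorem rpow_div_pow_mul (a : ℝ) (j : ℕ) {s E : ℝ} (hs : 0 < s) :
    s ^ a * (1 / (√s ^ j * E)) = s ^ (a - j / 2) / E := by
  rw [Real.rpow_sub hs, Real.sqrt_eq_rpow, ← Real.rpow_natCast, ← Real.rpow_mul hs.le,
    show (1 / 2 * (j : ℝ)) = j / 2 by ring]
  field_simp

/-- Rates for a pure power with an interior singularity. -/
theorem hasInterpRate_interior_power {ξ σ : ℝ} (hξ : |ξ| < 1) (hσ : 0 < σ)
    (hσ2 : ∀ k : ℤ, σ ≠ 2 * (k : ℝ)) {m : ℕ} (hm : (m : ℝ) < σ) (j : ℕ) :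
    HasInterpRate (fun x => |x - ξ| ^ σ * (x - ξ) ^ j) m (max (m : ℝ) (2 * m - 2) - σ) := by
  obtain ⟨k, p, C, hα, hC, hrep⟩ := exists_rpow_eq_integral (α := σ / 2) (by positivity)
    (fun k hk => hσ2 k (by linarith))
  have hσkp : 2 * (k + p) = σ := by rw [← hα]; ring
  obtain ⟨r, hr⟩ := exists_nat_gt (σ + j)
  -- With this δ, |x| ≥ 1 - δ implies |x - ξ| ≥ δ. The far region below uses δ/2 so as to be an open
  -- set.
  set δ := (1 - |ξ|) / 2 with hδ
  have hδ0 : 0 < δ := by have := sub_pos.2 hξ; positivity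
  have hδ1 : δ ≤ 1 := by have := abs_nonneg ξ; linarith
  choose K1 hK1 hbd1 using
    fun i => exists_norm_iteratedDeriv_interpKernel_le_interior hξ hδ0 hδ1 i r
  choose K2 hK2 hbd2 using
    fun i => exists_norm_iteratedDeriv_interpKernel_le_far hξ (half_pos hδ0) i r
  obtain ⟨c0, hc0, hlow⟩ := exists_le_norm_lobattoPoly_of_re hξ 0
  set f := fun x : ℝ => |x - ξ| ^ σ * (x - ξ) ^ j with hf
  have hfm : ContDiffOn ℝ m f (Icc (-1) 1) := (contDiff_abs_rpow_mul_pow hm ξ j).contDiffOn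
  set M := 2 * k + 2 + j
  set c : ℝ → ℂ := fun s => -Complex.I * ((C * s ^ (p - 3 / 2) : ℝ) : ℂ) with hcdef
  set t : ℝ → ℂ := fun s => (ξ : ℂ) + √s * Complex.I with htdef
  have hcm : Measurable c := by fun_prop
  have htm : Measurable t := by fun_prop
  have htre : ∀ s, (t s).re = ξ := fun s => by simp [htdef]
  have htim : ∀ s, (t s).im = √s := fun s => by simp [htdef]
  have htim0 : ∀ s, 0 < s → (t s).im ≠ 0 := fun s hs => by
    rw [htim]
    exact (Real.sqrt_pos.2 hs).ne'
  have hne : ∀ s, 0 < s → ∀ x ∈ Icc (-1 : ℝ) 1, (x : ℂ) ≠ t s := fun s hs x _ h =>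
    htim0 s hs (by rw [← h, Complex.ofReal_im])
  have heq : ∀ x : ℝ, EqOn
      (fun s => (x - ξ) ^ j * (C * s ^ (p - 1) * (((x - ξ) ^ 2) ^ (k + 1) / (s + (x - ξ) ^ 2))))
      (fun s => (c s * (((x : ℂ) - ξ) ^ M / ((x : ℂ) - t s))).re) (Ioi 0) := fun x s hs =>
    (interior_pole_identity ξ x k j p C hs).symm
  have hint : ∀ x ∈ Icc (-1 : ℝ) 1,
      IntegrableOn (fun s => (c s * (((x : ℂ) - ξ) ^ M / ((x : ℂ) - t s))).re) (Ioi 0) :=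
    fun x _ => IntegrableOn.congr_fun ((hrep _ (sq_nonneg (x - ξ))).1.const_mul _) (heq x)
      measurableSet_Ioi
  have hfint : ∀ x ∈ Icc (-1 : ℝ) 1,
      f x = ∫ s in Ioi (0 : ℝ), (c s * (((x : ℂ) - ξ) ^ M / ((x : ℂ) - t s))).re := by
    intro x _
    rw [← setIntegral_congr_fun measurableSet_Ioi (heq x), integral_const_mul,
      ← (hrep _ (sq_nonneg (x - ξ))).2, hf, ← sq_abs, ← Real.rpow_natCast |x - ξ| 2,
      ← Real.rpow_mul (abs_nonneg _)]
    simp only [Nat.cast_ofNat, show 2 * (σ / 2) = σ by ring]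
    ring
  have hcoef : ∀ s, 0 < s → ‖c s * (t s - ξ) ^ M‖ = C * s ^ ((σ + j) / 2 - 1 / 2) := by
    intro s hs
    have := norm_interior_pole_coeff ξ k j p hC hs
    rwa [hσkp] at this
  have hcast : ∀ i ≤ m, (i : ℝ) ≤ m := fun i hi => by exact_mod_cast hi
  have hj0 : (0 : ℝ) ≤ j := j.cast_nonneg
  set e := max (m : ℝ) (2 * m - 2) - σ with he
  set A1 := C * K1 m * decayIntegral ((σ + j - m) / 2 - 1) r
  set A2 := C * K2 m * decayIntegral ((σ + j) / 2 - 1) r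
  have hA1 : 0 ≤ A1 := mul_nonneg (mul_nonneg hC.le (hK1 m)) (decayIntegral_nonneg _ _)
  have hA2 : 0 ≤ A2 := mul_nonneg (mul_nonneg hC.le (hK2 m)) (decayIntegral_nonneg _ _)
  refine ⟨A1 + A2, ?_⟩
  filter_upwards [eventually_ge_atTop (r + m + 1 + M)] with n hn x hx
  have hn1 : 1 ≤ n := by omega
  have hn1' : (1 : ℝ) ≤ n := by exact_mod_cast hn1
  have hn0 : (0 : ℝ) < n := by linarith
  have hW : ∀ s, 0 < s → (lobattoPoly ℂ n).eval (t s) ≠ 0 := by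
    intro s hs h0
    have h1 := hlow n (t s) (by omega) (htre s)
    rw [h0, norm_zero] at h1
    have := abs_pos.2 (htim0 s hs)
    have : 0 < c0 * (n * |(t s).im| * (1 + (n * |(t s).im|) ^ 0)) := by positivity
    linarith
  -- Away from ±1 the weight exponent (σ + j - m)/2 - 1 yields n^(m-σ-j). Near ±1 it is (σ + j)/2 -
  -- 1, yielding n^(-σ-j) times the kernel factor n^(2m-1) / n.
  rcases lt_or_ge |x| (1 - δ) with hxδ | hxδ
  · have h := abs_chebDiffError_le_of_poles (U := Ioo (-(1 - δ)) (1 - δ)) (m := m) (r := r)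
      (D := fun i => C * K1 i) (b := fun i => (σ + j - i) / 2 - 1) hcm htm hn1
      (by omega : M ≤ n + 1) isOpen_Ioo
      (Ioo_subset_Ioo (by linarith) (by linarith)) hfm hne hW hint hfint
      (fun i hi => by linarith [hcast i hi]) (fun i hi => by
        have : (0 : ℝ) ≤ i := i.cast_nonneg
        linarith) ?_ x (abs_lt.1 hxδ)
    · refine h.trans ?_
      calc _ = A1 * (n : ℝ) ^ (-2 * ((σ + j - m) / 2 - 1) - 2) := by simp only [A1]; ring
        _ ≤ A1 * (n : ℝ) ^ e := by
            refine mul_le_mul_of_nonneg_left (Real.rpow_le_rpow_of_exponent_le hn1' ?_) hA1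
            rw [he]
            linarith [le_max_left (m : ℝ) (2 * m - 2)]
        _ ≤ _ := by gcongr; linarith
    · intro i hi s hs y hy
      have hb := hbd1 i n y (t s) (by omega) (abs_lt.2 hy).le (htre s) (htim0 s hs)
      rw [htim, abs_of_nonneg (Real.sqrt_nonneg s)] at hb
      rw [hcoef s hs]
      refine (mul_le_mul_of_nonneg_left hb (by positivity)).trans_eq ?_
      calc _ = C * K1 i * (s ^ ((σ + j) / 2 - 1 / 2) * (1 / (√s ^ (i + 1) * (1 + (n * √s) ^ r)))) := by
            ring
        _ = _ := by
            rw [rpow_div_pow_mul _ _ hs]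
            push_cast
            ring_nf
  · have hfar : x ∈ Ioo (-1 : ℝ) 1 ∩ {y | δ / 2 < |y - ξ|} := by
      refine ⟨hx, ?_⟩
      have h1 := abs_sub_abs_le_abs_sub x ξ
      have h2 : δ = 1 - δ - |ξ| := by rw [hδ]; ring
      simp only [mem_ofPred_eq]
      linarith
    have h := abs_chebDiffError_le_of_poles (U := Ioo (-1 : ℝ) 1 ∩ {y | δ / 2 < |y - ξ|}) (m := m)
      (r := r) (D := fun i => C * K2 i * ((n : ℝ) ^ (2 * i - 1) / n))
      (b := fun _ => (σ + j) / 2 - 1) hcm htm hn1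
      (by omega : M ≤ n + 1) (isOpen_Ioo.inter (isOpen_lt continuous_const (by fun_prop)))
      inter_subset_left hfm hne hW hint hfint
      (fun i hi => by linarith) (fun i hi => by linarith) ?_ x hfar
    · refine h.trans ?_
      calc _ = A2 * ((n : ℝ) ^ (2 * m - 1) / n * (n : ℝ) ^ (-2 * ((σ + j) / 2 - 1) - 2)) := by
            simp only [A2]; ring
        _ = A2 * (n : ℝ) ^ (((2 * m - 1 : ℕ) : ℝ) - 1 + (-2 * ((σ + j) / 2 - 1) - 2)) := by
            rw [Real.rpow_add hn0, Real.rpow_sub_one hn0.ne', Real.rpow_natCast]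
        _ ≤ A2 * (n : ℝ) ^ e := by
            refine mul_le_mul_of_nonneg_left (Real.rpow_le_rpow_of_exponent_le hn1' ?_) hA2
            rw [he]
            -- For m = 0 the truncated 2m - 1 is 0, so the exponent is -1 - σ - j, and m - σ in the
            -- maximum suffices.
            rcases m with _ | m
            · simp
              linarith
            · have : ((2 * (m + 1) - 1 : ℕ) : ℝ) = 2 * (m + 1 : ℕ) - 1 := by
                rw [Nat.cast_sub (by omega)]
                push_cast
                ring
              rw [this]
              linarith [le_max_right ((m + 1 : ℕ) : ℝ) (2 * (m + 1 : ℕ) - 2)]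
        _ ≤ _ := by gcongr; linarith
    · intro i hi s hs y hy
      have hb := hbd2 i n y (t s) (by omega) (abs_lt.2 hy.1).le (le_of_lt hy.2) (htre s) (htim0 s hs)
      rw [htim, abs_of_nonneg (Real.sqrt_nonneg s)] at hb
      rw [hcoef s hs]
      refine (mul_le_mul_of_nonneg_left hb (by positivity)).trans_eq ?_
      calc _ = C * K2 i * ((n : ℝ) ^ (2 * i - 1) / n) *
            (s ^ ((σ + j) / 2 - 1 / 2) * (1 / (√s ^ 1 * (1 + (n * √s) ^ r)))) := by
            field_simp
        _ = _ := by
            rw [rpow_div_pow_mul _ _ hs]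
            push_cast
            ring_nf

/-- At an endpoint x - ξ has constant sign on [-1, 1], so |x - ξ| is itself a polynomial there and
no squaring is needed. -/
theorem abs_sub_eq_one_sub_mul {ξ : ℝ} (hξ : ξ = -1 ∨ ξ = 1) {x : ℝ} (hx : x ∈ Icc (-1 : ℝ) 1) :
    |x - ξ| = -ξ * (x - ξ) := by
  obtain ⟨h1, h2⟩ := hx
  rcases hξ with rfl | rfl
  · rw [abs_of_nonneg (by linarith)]; ring
  · rw [abs_of_nonpos (by linarith)]; ring

/-- Of the k + 1 signs relating (x - ξ)^(k+1) to |x - ξ|^(k+1), k are absorbed by the coefficient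
(-ξ)^k and one by the denominator. -/
theorem endpoint_pole_identity {ξ : ℝ} (hξ : ξ = -1 ∨ ξ = 1) (k j : ℕ) (p C : ℝ) {x s : ℝ}
    (hx : x ∈ Icc (-1 : ℝ) 1) (hs : 0 < s) :
    (((C * s ^ (p - 1) * (-ξ) ^ k : ℝ) : ℂ) *
      (((x : ℂ) - ξ) ^ (k + 1 + j) / ((x : ℂ) - ((ξ + ξ * s : ℝ) : ℂ)))).re =
    (x - ξ) ^ j * (C * s ^ (p - 1) * (|x - ξ| ^ (k + 1) / (s + |x - ξ|))) := by
  have hab := abs_sub_eq_one_sub_mul hξ hx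
  have hξ2 : ξ ^ 2 = 1 := by rcases hξ with rfl | rfl <;> norm_num
  have hξk : (-ξ) ^ k * (-ξ) ^ k = 1 := by
    rw [← mul_pow, neg_mul_neg, ← sq, hξ2, one_pow]
  have hpos : 0 < s + |x - ξ| := by positivity
  have hden : x - (ξ + ξ * s) = -ξ * (s + |x - ξ|) := by
    rw [hab]
    linear_combination -(x - ξ) * hξ2
  have hξ0 : -ξ ≠ 0 := by
    rcases hξ with rfl | rfl <;> norm_num
  have e : (((C * s ^ (p - 1) * (-ξ) ^ k : ℝ) : ℂ) *
      (((x : ℂ) - ξ) ^ (k + 1 + j) / ((x : ℂ) - ((ξ + ξ * s : ℝ) : ℂ)))) =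
      ((C * s ^ (p - 1) * (-ξ) ^ k * ((x - ξ) ^ (k + 1 + j) / (x - (ξ + ξ * s))) : ℝ) : ℂ) := by
    push_cast
    rfl
  have hx1 : x - ξ = -ξ * |x - ξ| := by
    rw [hab]
    linear_combination -(x - ξ) * hξ2
  have hpow : (x - ξ) ^ (k + 1 + j) = (-ξ) ^ k * -ξ * |x - ξ| ^ (k + 1) * (x - ξ) ^ j := by
    rw [pow_add]
    nth_rewrite 1 [hx1]
    rw [mul_pow, pow_succ (-ξ)]
  rw [e, Complex.ofReal_re, hden, hpow, mul_comm ((-ξ) ^ k) (-ξ), mul_assoc (-ξ), mul_assoc (-ξ),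
    mul_div_mul_left _ _ hξ0]
  linear_combination
    ((x - ξ) ^ j * |x - ξ| ^ (k + 1) / (s + |x - ξ|) * C * s ^ (p - 1)) * hξk

/-- Rates for a pure power with a singularity at an endpoint. -/
theorem hasInterpRate_endpoint_power {ξ σ : ℝ} (hξ : ξ = -1 ∨ ξ = 1) (hσ : 0 < σ)
    (hσ2 : ∀ k : ℤ, σ ≠ (k : ℝ)) {m : ℕ} (hm : (m : ℝ) < σ) (j : ℕ) :
    HasInterpRate (fun x => |x - ξ| ^ σ * (x - ξ) ^ j) m (2 * m - 2 * σ) := by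
  obtain ⟨k, p, C, hα, hC, hrep⟩ := exists_rpow_eq_integral hσ hσ2
  obtain ⟨r, hr⟩ := exists_nat_gt (2 * (σ + j))
  have hξ1 : |ξ| = 1 := by rcases hξ with rfl | rfl <;> norm_num
  have hξ2 : ξ ^ 2 = 1 := by rcases hξ with rfl | rfl <;> norm_num
  choose K hK hbd using fun i => exists_norm_iteratedDeriv_interpKernel_le_endpoint i r
  obtain ⟨c0, hc0, hlow⟩ := exists_le_norm_lobattoPoly_of_norm 0
  set f := fun x : ℝ => |x - ξ| ^ σ * (x - ξ) ^ j with hf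
  have hfm : ContDiffOn ℝ m f (Icc (-1) 1) := (contDiff_abs_rpow_mul_pow hm ξ j).contDiffOn
  set M := k + 1 + j
  set c : ℝ → ℂ := fun s => ((C * s ^ (p - 1) * (-ξ) ^ k : ℝ) : ℂ) with hcdef
  set t : ℝ → ℂ := fun s => ((ξ + ξ * s : ℝ) : ℂ) with htdef
  have hcm : Measurable c := by fun_prop
  have htm : Measurable t := by fun_prop
  have htn : ∀ s, 0 < s → ‖t s‖ = 1 + s := fun s hs => by
    rw [htdef, Complex.norm_real, Real.norm_eq_abs, show ξ + ξ * s = ξ * (1 + s) by ring, abs_mul,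
      hξ1, one_mul, abs_of_pos (by positivity)]
  have hdist : ∀ s, 0 < s → ∀ x ∈ Icc (-1 : ℝ) 1, ‖(x : ℂ) - t s‖ = |x - ξ| + s := by
    intro s hs x hx
    have hab := abs_sub_eq_one_sub_mul hξ hx
    have h1 : x - (ξ + ξ * s) = -ξ * (|x - ξ| + s) := by
      rw [hab]
      linear_combination -(x - ξ) * hξ2
    rw [htdef, ← Complex.ofReal_sub, Complex.norm_real, Real.norm_eq_abs, h1, abs_mul, abs_neg, hξ1,
      one_mul, abs_of_pos (by positivity)]
  have hne : ∀ s, 0 < s → ∀ x ∈ Icc (-1 : ℝ) 1, (x : ℂ) ≠ t s := fun s hs x hx h => by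
    have h1 := hdist s hs x hx
    rw [h, sub_self, norm_zero] at h1
    linarith [abs_nonneg (x - ξ)]
  have heq : ∀ x ∈ Icc (-1 : ℝ) 1, EqOn
      (fun s => (x - ξ) ^ j * (C * s ^ (p - 1) * (|x - ξ| ^ (k + 1) / (s + |x - ξ|))))
      (fun s => (c s * (((x : ℂ) - ξ) ^ M / ((x : ℂ) - t s))).re) (Ioi 0) := fun x hx s hs =>
    (endpoint_pole_identity hξ k j p C hx hs).symm
  have hint : ∀ x ∈ Icc (-1 : ℝ) 1,
      IntegrableOn (fun s => (c s * (((x : ℂ) - ξ) ^ M / ((x : ℂ) - t s))).re) (Ioi 0) :=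
    fun x hx => IntegrableOn.congr_fun ((hrep _ (abs_nonneg (x - ξ))).1.const_mul _) (heq x hx)
      measurableSet_Ioi
  have hfint : ∀ x ∈ Icc (-1 : ℝ) 1,
      f x = ∫ s in Ioi (0 : ℝ), (c s * (((x : ℂ) - ξ) ^ M / ((x : ℂ) - t s))).re := by
    intro x hx
    rw [← setIntegral_congr_fun measurableSet_Ioi (heq x hx), integral_const_mul,
      ← (hrep _ (abs_nonneg (x - ξ))).2, hf]
    ring
  have hcoef : ∀ s, 0 < s → ‖c s * (t s - ξ) ^ M‖ = C * s ^ (σ + j) := by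
    intro s hs
    have e : t s - ξ = ((ξ * s : ℝ) : ℂ) := by simp [htdef]
    rw [e, norm_mul, norm_pow, hcdef, Complex.norm_real, Complex.norm_real, Real.norm_eq_abs,
      Real.norm_eq_abs, abs_mul, abs_mul, abs_mul, abs_pow, abs_neg, hξ1, one_pow, one_mul, mul_one,
      abs_of_pos hC, abs_of_pos hs, abs_of_pos (by positivity), mul_assoc, ← Real.rpow_natCast,
      ← Real.rpow_add hs, hα]
    congr 2
    simp only [M]
    push_cast
    ring
  have hcast : ∀ i ≤ m, (i : ℝ) ≤ m := fun i hi => by exact_mod_cast hi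
  have hj0 : (0 : ℝ) ≤ j := j.cast_nonneg
  -- The coefficient s^(σ+j) times the kernel bound s^(-(m+1)) has exponent b = σ + j - m - 1, and
  -- -2b - 2 = 2m - 2σ - 2j.
  set A := C * K m * decayIntegral (σ + j - m - 1) r
  have hA : 0 ≤ A := mul_nonneg (mul_nonneg hC.le (hK m)) (decayIntegral_nonneg _ _)
  refine ⟨A, ?_⟩
  filter_upwards [eventually_ge_atTop (r + 2 * m + 1 + M)] with n hn x hx
  have hn1 : 1 ≤ n := by omega
  have hn1' : (1 : ℝ) ≤ n := by exact_mod_cast hn1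
  have hn0 : (0 : ℝ) < n := by linarith
  have hW : ∀ s, 0 < s → (lobattoPoly ℂ n).eval (t s) ≠ 0 := by
    intro s hs h0
    have h1 := hlow n (t s) s (by omega) hs.le (htn s hs).ge
    rw [h0, norm_zero] at h1
    have : 0 < c0 * (n * s * (1 + (n * √s) ^ 0)) := by positivity
    linarith
  have h := abs_chebDiffError_le_of_poles (U := Ioo (-1 : ℝ) 1) (m := m) (r := r)
    (D := fun i => C * K i) (b := fun i => σ + j - i - 1) hcm htm hn1
    (by omega : M ≤ n + 1) isOpen_Ioo subset_rfl hfm hne hW hint hfint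
    (fun i hi => by linarith [hcast i hi]) (fun i hi => by
      have : (0 : ℝ) ≤ i := i.cast_nonneg
      linarith) ?_ x hx
  · refine h.trans ?_
    calc _ = A * (n : ℝ) ^ (-2 * (σ + j - m - 1) - 2) := by simp only [A]; ring
      _ ≤ A * (n : ℝ) ^ (2 * (m : ℝ) - 2 * σ) := by
          refine mul_le_mul_of_nonneg_left (Real.rpow_le_rpow_of_exponent_le hn1' ?_) hA
          linarith
  · intro i hi s hs y hy
    have hy' := Ioo_subset_Icc_self hy
    have hd := hdist s hs y hy'
    have hb := hbd i n y s (t s) (by omega) (abs_le.2 hy') hs (htn s hs).ge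
      (by rw [hd]; linarith [abs_nonneg (y - ξ)])
      (by
        rw [hd]
        have hab := abs_sub_eq_one_sub_mul hξ hy'
        obtain ⟨h1, h2⟩ := hy'
        rcases hξ with rfl | rfl <;> rw [hab] <;> nlinarith)
    rw [hcoef s hs]
    refine (mul_le_mul_of_nonneg_left hb (by positivity)).trans_eq ?_
    have e : s ^ (σ + j - i - 1) = s ^ (σ + j) / s ^ (i + 1) := by
      rw [← Real.rpow_natCast, ← Real.rpow_sub hs]
      push_cast
      ring_nf
    simp only [e]
    field_simp

end PowerFunctions

/-! ### Decay of Fourier coefficients of smooth periodic functions. -/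

section FourierCoefficients

open MeasureTheory Set intervalIntegral

theorem periodic_iteratedDeriv {F : ℝ → ℂ} {T : ℝ} (hF : Function.Periodic F T) (j : ℕ) :
    Function.Periodic (iteratedDeriv j F) T := by
  intro x
  have h := congrFun (iteratedDeriv_comp_add_const j F T) x
  rw [show (fun z => F (z + T)) = F from funext hF] at h
  exact h.symm

/-- Integration by parts; the boundary terms cancel by periodicity. -/
theorem integral_fourier_mul_deriv {G G' : ℝ → ℂ} (hG : ∀ x, HasDerivAt G (G' x) x)
    (hG' : Continuous G') (hper : Function.Periodic G (2 * Real.pi)) (k : ℤ) :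
    ∫ x in (0 : ℝ)..2 * Real.pi, Complex.exp (-(k * x * Complex.I)) * G' x =
      (k * Complex.I) * ∫ x in (0 : ℝ)..2 * Real.pi, Complex.exp (-(k * x * Complex.I)) * G x := by
  have hu : ∀ x : ℝ, HasDerivAt (fun x : ℝ => Complex.exp (-(k * x * Complex.I)))
      (-(k * Complex.I) * Complex.exp (-(k * x * Complex.I))) x := by
    intro x
    have h1 : HasDerivAt (fun x : ℝ => -((k : ℂ) * x * Complex.I)) (-(k * Complex.I)) x := by
      have h0 : HasDerivAt (fun x : ℝ => (x : ℂ)) 1 x := (hasDerivAt_id x).ofReal_comp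
      simpa using ((h0.const_mul (k : ℂ)).mul_const Complex.I).fun_neg
    simpa [mul_comm] using h1.cexp
  have hcont : Continuous fun x : ℝ => Complex.exp (-(k * x * Complex.I)) := by fun_prop
  rw [integral_mul_deriv_eq_deriv_mul (fun x _ => hu x) (fun x _ => hG x)
    ((continuous_const.mul hcont).intervalIntegrable _ _) (hG'.intervalIntegrable _ _)]
  have h2 : G (2 * Real.pi) = G 0 := by simpa using hper 0
  have h3 : Complex.exp (-(k * ((2 * Real.pi : ℝ) : ℂ) * Complex.I)) = 1 := by
    rw [Complex.exp_eq_one_iff]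
    exact ⟨-k, by push_cast; ring⟩
  rw [h2, h3]
  simp only [Complex.ofReal_zero, mul_zero, zero_mul, neg_zero, Complex.exp_zero, one_mul, sub_self,
    zero_sub]
  rw [← intervalIntegral.integral_const_mul, ← intervalIntegral.integral_neg]
  congr 1
  funext x
  ring

theorem integral_fourier_mul_iteratedDeriv {F : ℝ → ℂ} {N : ℕ} (hF : ContDiff ℝ N F)
    (hper : Function.Periodic F (2 * Real.pi)) (k : ℤ) :
    ∀ j ≤ N, ∫ x in (0 : ℝ)..2 * Real.pi,
        Complex.exp (-(k * x * Complex.I)) * iteratedDeriv j F x =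
      (k * Complex.I) ^ j * ∫ x in (0 : ℝ)..2 * Real.pi, Complex.exp (-(k * x * Complex.I)) * F x := by
  intro j
  induction j with
  | zero => simp
  | succ j ih =>
    intro hj
    rw [integral_fourier_mul_deriv (G := iteratedDeriv j F) ?_
      (hF.continuous_iteratedDeriv _ (by exact_mod_cast hj)) (periodic_iteratedDeriv hper j),
      ih (by omega), pow_succ']
    · ring
    · intro x
      rw [iteratedDeriv_succ]
      exact (hF.differentiable_iteratedDeriv j (by exact_mod_cast hj) x).hasDerivAt

theorem exists_fourier_integral_le {F : ℝ → ℂ} {N : ℕ} (hF : ContDiff ℝ N F)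
    (hper : Function.Periodic F (2 * Real.pi)) :
    ∃ C, 0 ≤ C ∧ ∀ k : ℤ,
      |(k : ℝ)| ^ N * ‖∫ x in (0 : ℝ)..2 * Real.pi, Complex.exp (-(k * x * Complex.I)) * F x‖ ≤ C := by
  have hc := hF.continuous_iteratedDeriv N le_rfl
  obtain ⟨C, hC⟩ := (isCompact_Icc (a := (0 : ℝ)) (b := 2 * Real.pi)).exists_bound_of_continuousOn
    hc.continuousOn
  have hC0 : 0 ≤ C := (norm_nonneg _).trans (hC 0 ⟨le_rfl, by positivity⟩)
  refine ⟨C * |2 * Real.pi - 0|, by positivity, fun k => ?_⟩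
  have h := integral_fourier_mul_iteratedDeriv hF hper k N le_rfl
  have h2 := congrArg norm h
  rw [norm_mul, norm_pow, norm_mul, Complex.norm_I, mul_one, Complex.norm_intCast] at h2
  rw [← h2]
  refine norm_integral_le_of_norm_le_const fun x hx => ?_
  rw [uIoc_of_le (by positivity)] at hx
  rw [norm_mul, Complex.norm_exp]
  simpa using hC x ⟨hx.1.le, hx.2⟩

end FourierCoefficients

/-! ### Chebyshev series, aliasing and interpolation of smooth functions. -/

section ChebyshevSeries

open MeasureTheory Set Polynomial

/-- A sufficiently smooth function has a rapidly converging Chebyshev series, indexed here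
symmetrically by the integers. -/
theorem exists_hasSum_chebyshev {f : ℝ → ℝ} {N : ℕ} (hN : 2 ≤ N)
    (hf : ∀ x ∈ Icc (-1 : ℝ) 1, ContDiffAt ℝ N f x) :
    ∃ (b : ℤ → ℝ) (C : ℝ), 0 ≤ C ∧ (∀ k : ℤ, |(k : ℝ)| ^ N * |b k| ≤ C) ∧
      ∀ x ∈ Icc (-1 : ℝ) 1, HasSum (fun k => b k * (Chebyshev.T ℝ k).eval x) (f x) := by
  set F : ℝ → ℂ := fun θ => (f (Real.cos θ) : ℂ) with hFdef
  have hF : ContDiff ℝ N F := contDiff_iff_contDiffAt.2 fun θ =>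
    Complex.ofRealCLM.contDiff.contDiffAt.comp θ ((hf _ ⟨Real.neg_one_le_cos θ, Real.cos_le_one θ⟩).comp
      θ Real.contDiff_cos.contDiffAt)
  have hper : Function.Periodic F (2 * Real.pi) := fun θ => by simp [hFdef]
  have : Fact (0 < 2 * Real.pi) := ⟨by positivity⟩
  obtain ⟨C, hC, hbound⟩ := exists_fourier_integral_le hF hper
  set Φ : C(AddCircle (2 * Real.pi), ℂ) := ⟨hper.lift, hF.continuous.quotient_liftOn' _⟩ with hΦ
  have hΦc : ∀ θ : ℝ, Φ (θ : AddCircle (2 * Real.pi)) = F θ := fun θ => rfl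
  have hcoeff : ∀ k : ℤ, fourierCoeff Φ k =
      (1 / (2 * Real.pi) : ℝ) •
        ∫ x in (0 : ℝ)..2 * Real.pi, Complex.exp (-(k * x * Complex.I)) * F x := by
    intro k
    rw [fourierCoeff_eq_intervalIntegral _ k 0, zero_add]
    congr 1
    refine intervalIntegral.integral_congr fun x _ => ?_
    simp only [hΦc, smul_eq_mul, fourier_coe_apply]
    congr 2
    push_cast
    field_simp
  have hcb : ∀ k : ℤ, |(k : ℝ)| ^ N * ‖fourierCoeff Φ k‖ ≤ C := by
    intro k
    rw [hcoeff, norm_smul, Real.norm_of_nonneg (by positivity)]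
    have h1 : 1 / (2 * Real.pi) ≤ 1 := by
      rw [div_le_one (by positivity)]
      linarith [Real.pi_gt_three]
    have h2 := hbound k
    have h3 : 0 ≤ |(k : ℝ)| ^ N *
      ‖∫ x in (0 : ℝ)..2 * Real.pi, Complex.exp (-(k * x * Complex.I)) * F x‖ := by positivity
    have h4 : 0 ≤ 1 / (2 * Real.pi) := by positivity
    nlinarith
  have hsum : Summable (fourierCoeff Φ) := by
    have h1 : Summable fun k : ℤ => C * (1 / |(k : ℝ)| ^ N) := by
      refine Summable.mul_left _ ?_
      have := Real.summable_one_div_int_pow.2 (show 1 < N by omega)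
      simpa [abs_div, abs_pow] using this.abs
    refine Summable.of_norm_bounded_eventually h1 ?_
    have h2 : ({0} : Set ℤ).Finite := Set.finite_singleton 0
    filter_upwards [h2.compl_mem_cofinite] with k hk
    have hk0 : (0 : ℝ) < |(k : ℝ)| := abs_pos.2 (by exact_mod_cast hk)
    rw [mul_one_div, le_div_iff₀ (by positivity), mul_comm]
    exact hcb k
  refine ⟨fun k => (fourierCoeff Φ k).re, C, hC, fun k =>
    (mul_le_mul_of_nonneg_left (Complex.abs_re_le_norm _) (by positivity)).trans (hcb k), ?_⟩
  intro x hx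
  set θ := Real.arccos x
  have hxθ : Real.cos θ = x := Real.cos_arccos hx.1 hx.2
  have h1 := has_pointwise_sum_fourier_series_of_summable hsum (θ : AddCircle (2 * Real.pi))
  have h2 := has_pointwise_sum_fourier_series_of_summable hsum ((-θ : ℝ) : AddCircle (2 * Real.pi))
  -- Averaging the Fourier series of f ∘ cos at θ and -θ turns exponentials into cosines, so
  -- symmetry of the coefficients need not be proved.
  have h3 := Complex.hasSum_re ((h1.add h2).mul_left (1 / 2 : ℂ))
  rw [hΦc, hΦc] at h3
  have e1 : (1 / 2 * (F θ + F (-θ)) : ℂ).re = f x := by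
    rw [hFdef]
    simp only [Real.cos_neg, hxθ]
    rw [← two_mul, ← mul_assoc]
    norm_num
  rw [e1] at h3
  convert! h3 using 2 with k
  have e2 : (1 / 2 : ℂ) * (fourierCoeff Φ k • fourier k (θ : AddCircle (2 * Real.pi)) +
      fourierCoeff Φ k • fourier k ((-θ : ℝ) : AddCircle (2 * Real.pi))) =
      fourierCoeff Φ k * ((Real.cos (k * θ) : ℝ) : ℂ) := by
    rw [fourier_coe_apply, fourier_coe_apply, Complex.ofReal_cos, Complex.cos]
    have hpi : (Real.pi : ℂ) ≠ 0 := by exact_mod_cast Real.pi_ne_zero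
    have a1 : 2 * (Real.pi : ℂ) * Complex.I * k * θ / ((2 * Real.pi : ℝ) : ℂ) =
        ((k * θ : ℝ) : ℂ) * Complex.I := by
      push_cast
      field_simp
    have a2 : 2 * (Real.pi : ℂ) * Complex.I * k * ((-θ : ℝ) : ℂ) / ((2 * Real.pi : ℝ) : ℂ) =
        -((k * θ : ℝ) : ℂ) * Complex.I := by
      push_cast
      field_simp
    rw [a1, a2]
    simp only [smul_eq_mul]
    ring
  rw [e2, Complex.re_mul_ofReal, ← hxθ, Chebyshev.T_real_cos]

/-- Indices congruent modulo 2n give the same T at the nodes. The balanced residue lies in [-n, n);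
indices with |k| ≤ n are kept unchanged, since k = n would otherwise become -n. -/
theorem exists_alias {n : ℕ} (hn : 1 ≤ n) (k : ℤ) :
    ∃ l : ℤ, l.natAbs ≤ n ∧ (k.natAbs ≤ n → l = k) ∧
      ∀ j : ℕ, (Chebyshev.T ℝ l).eval (Real.cos (j * Real.pi / n)) =
        (Chebyshev.T ℝ k).eval (Real.cos (j * Real.pi / n)) := by
  by_cases hk : k.natAbs ≤ n
  · exact ⟨k, hk, fun _ => rfl, fun _ => rfl⟩
  refine ⟨Int.bmod k (2 * n), ?_, fun h => absurd h hk, fun j => ?_⟩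
  · have h1 := Int.bmod_lt (x := k) (m := 2 * n) (by omega)
    have h2 := Int.le_bmod (x := k) (m := 2 * n) (by omega)
    push_cast at h1 h2
    omega
  · obtain ⟨q, hq⟩ : ∃ q : ℤ, k = Int.bmod k (2 * n) + (2 * n : ℕ) * q :=
      ⟨Int.bdiv k (2 * n), (Int.bmod_add_bdiv k (2 * n)).symm⟩
    rw [Chebyshev.T_real_cos, Chebyshev.T_real_cos]
    have hn0 : (n : ℝ) ≠ 0 := by positivity
    have e : (k : ℝ) * (j * Real.pi / n) =
        (Int.bmod k (2 * n) : ℤ) * (j * Real.pi / n) + ((q * j : ℤ) : ℝ) * (2 * Real.pi) := by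
      have hq' : (k : ℝ) = (Int.bmod k (2 * n) : ℤ) + (2 * n : ℕ) * (q : ℝ) := by exact_mod_cast hq
      rw [hq']
      push_cast
      field_simp
    rw [e, Real.cos_add_int_mul_two_pi]

/-- Sufficiently smooth functions have algebraic interpolation rates of high order. -/
theorem hasInterpRate_of_contDiffAt {f : ℝ → ℝ} {m K N : ℕ} (hN : 2 * m + K + 2 ≤ N)
    (hf : ∀ x ∈ Icc (-1 : ℝ) 1, ContDiffAt ℝ N f x) :
    HasInterpRate f m (-(K : ℝ)) := by
  obtain ⟨b, C, hC, hb, hsum⟩ := exists_hasSum_chebyshev (N := N) (by omega) hf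
  have hfm : ContDiffOn ℝ m f (Icc (-1) 1) := fun x hx =>
    ((hf x hx).of_le (by exact_mod_cast (by omega : m ≤ N))).contDiffWithinAt
  have hS : Summable fun k : ℤ => 1 / (k : ℝ) ^ 2 := Real.summable_one_div_int_pow.2 one_lt_two
  refine ⟨2 * C * ∫ k : ℤ, 1 / (k : ℝ) ^ 2 ∂Measure.count, ?_⟩
  filter_upwards [eventually_ge_atTop 1] with n hn x hx
  have hn0 : (0 : ℝ) < n := by exact_mod_cast hn
  choose l hl hlk hlT using exists_alias hn
  -- P k is the interpolation error of the k-th term. It vanishes for |k| ≤ n; the series is handled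
  -- as an integral for counting measure.
  set P : ℤ → ℝ[X] := fun k => Polynomial.C (b k) * (Chebyshev.T ℝ k - Chebyshev.T ℝ (l k)) with hP
  have hPd : ∀ j k y, (derivative^[j] (P k)).eval y =
      b k * ((derivative^[j] (Chebyshev.T ℝ k)).eval y -
        (derivative^[j] (Chebyshev.T ℝ (l k))).eval y) := by
    intro j k y
    rw [hP, iterate_derivative_C_mul, iterate_derivative_sub, eval_mul, eval_C, eval_sub]
  have h := abs_chebDiffError_le_integral (μ := (Measure.count : Measure ℤ)) (n := n) (m := m)
    (f := f) (A := fun k x => b k * (Chebyshev.T ℝ k).eval x) (H := fun k x => (P k).eval x)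
    (B := fun _ k => 2 * C * (n : ℝ) ^ (-(K : ℝ)) * (1 / (k : ℝ) ^ 2)) isOpen_Ioo subset_rfl hfm
    ?_ ?_ ?_ ?_ ?_ ?_ ?_ hx
  · refine h.trans_eq ?_
    rw [integral_const_mul]
    ring
  · intro y hy
    exact integrable_count_iff.2 (hsum y hy).summable.abs
  · intro y hy
    have hi : Integrable (fun k => b k * (Chebyshev.T ℝ k).eval y) (Measure.count : Measure ℤ) :=
      integrable_count_iff.2 (hsum y hy).summable.abs
    rw [integral_countable hi]
    simpa [Measure.real] using (hsum y hy).tsum_eq.symm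
  · refine Eventually.of_forall fun k y hy => ?_
    refine interpErr_eq_of_eq_add (q := Polynomial.C (b k) * Chebyshev.T ℝ (l k))
      (e := fun y => (P k).eval y) ?_ ?_ ?_ hy
    · refine (natDegree_C_mul_le _ _).trans ?_
      rw [Chebyshev.natDegree_T]
      exact hl k
    · intro z _
      simp only [hP, eval_mul, eval_C, eval_sub]
      ring
    · intro j
      simp [hP, hlT k j]
  · refine Eventually.of_forall fun k y _ => ?_
    have hc : ContDiff ℝ m (fun x : ℝ => (P k).eval x) := by
      simpa only [Polynomial.coe_aeval_eq_eval] using (P k).contDiff_aeval (𝕜 := ℝ) m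
    exact hc.contDiffAt
  · exact fun j _ y _ => (Measurable.of_discrete).aestronglyMeasurable
  · intro j hj
    refine Eventually.of_forall fun k y hy => ?_
    rw [iteratedDeriv_eval]
    beta_reduce
    rw [hPd]
    by_cases hk : k.natAbs ≤ n
    · rw [hlk k hk, sub_self, mul_zero, abs_zero]
      positivity
    · have hkn : (n : ℝ) ≤ |(k : ℝ)| := by
        rw [← Int.cast_abs, Int.abs_eq_natAbs]
        exact_mod_cast (by omega : n ≤ k.natAbs)
      have hln : |(l k : ℝ)| ≤ |(k : ℝ)| := by
        refine le_trans ?_ hkn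
        rw [← Int.cast_abs, Int.abs_eq_natAbs]
        exact_mod_cast hl k
      have hn1 : (1 : ℝ) ≤ n := by exact_mod_cast hn
      have hy1 : |y| ≤ 1 := (abs_lt.2 hy).le
      set κ := |(k : ℝ)| with hκ
      have hκ1 : 1 ≤ κ := hn1.trans hkn
      have h1 : |(derivative^[j] (Chebyshev.T ℝ k)).eval y| ≤ κ ^ (2 * j) := by
        refine (abs_iterate_derivative_T_le_pow k j hy1).trans_eq ?_
        rw [hκ, pow_mul, pow_mul, sq_abs]
      have h2 : |(derivative^[j] (Chebyshev.T ℝ (l k))).eval y| ≤ κ ^ (2 * j) := by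
        refine (abs_iterate_derivative_T_le_pow (l k) j hy1).trans ?_
        rw [pow_mul, ← sq_abs, ← pow_mul]
        gcongr
      -- Of these powers, 2j pay for the derivatives, K give the rate because κ ≥ n, and 2 ensure
      -- summability over k.
      have h3 : |b k| ≤ C / κ ^ (2 * j + K + 2) := by
        rw [le_div_iff₀ (by positivity), mul_comm]
        refine le_trans ?_ (hb k)
        gcongr
        omega
      have h4 : (n : ℝ) ^ K ≤ κ ^ K := by gcongr
      rw [abs_mul, ← sq_abs (k : ℝ), ← hκ, Real.rpow_neg hn0.le, Real.rpow_natCast]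
      calc |b k| * _ ≤ C / κ ^ (2 * j + K + 2) * (κ ^ (2 * j) + κ ^ (2 * j)) := by
            gcongr
            exact (abs_sub _ _).trans (add_le_add h1 h2)
        _ = 2 * C * (κ ^ K)⁻¹ * (1 / κ ^ 2) := by
            rw [pow_add, pow_add]
            field_simp
            ring
        _ ≤ 2 * C * ((n : ℝ) ^ K)⁻¹ * (1 / κ ^ 2) := by gcongr
  · intro j _
    exact (integrable_count_iff.2 (by simpa using hS.abs)).const_mul _

end ChebyshevSeries

/-! ### Exact Taylor expansion with analytic remainder. -/

section Taylor

theorem AnalyticOnNhd.dslope {g : ℝ → ℝ} {s : Set ℝ} (hg : AnalyticOnNhd ℝ g s) (ξ : ℝ)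
    (hξ : ξ ∈ s) : AnalyticOnNhd ℝ (dslope g ξ) s := by
  intro x hx
  by_cases h : x = ξ
  · subst h
    obtain ⟨p, hp⟩ := hg x hx
    exact hp.has_fpower_series_dslope_fslope.analyticAt
  · have h1 : AnalyticAt ℝ (fun y => (y - ξ)⁻¹ * (g y - g ξ)) x :=
      ((analyticAt_id.fun_sub analyticAt_const).fun_inv (sub_ne_zero.2 h)).fun_mul
        ((hg x hx).fun_sub analyticAt_const)
    refine h1.congr ?_
    filter_upwards [dslope_eventuallyEq_slope_of_ne g h] with y hy
    rw [hy, slope_def_field, div_eq_inv_mul]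

/-- Iterated divided differences at ξ: each is again analytic, and its value at ξ is the next
coefficient. -/
theorem exists_taylor_analyticOnNhd {g : ℝ → ℝ} {s : Set ℝ} (hg : AnalyticOnNhd ℝ g s) {ξ : ℝ}
    (hξ : ξ ∈ s) (N : ℕ) : ∃ (c : ℕ → ℝ) (G : ℝ → ℝ), AnalyticOnNhd ℝ G s ∧
      ∀ x, g x = (∑ j ∈ Finset.range N, c j * (x - ξ) ^ j) + (x - ξ) ^ N * G x := by
  have hG : ∀ j, AnalyticOnNhd ℝ ((fun h => dslope h ξ)^[j] g) s := by
    intro j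
    induction j with
    | zero => exact hg
    | succ j ih =>
      rw [Function.iterate_succ_apply']
      exact ih.dslope ξ hξ
  refine ⟨fun j => (fun h => dslope h ξ)^[j] g ξ, (fun h => dslope h ξ)^[N] g, hG N, fun x => ?_⟩
  induction N with
  | zero => simp
  | succ N ih =>
    have h := sub_smul_dslope ((fun h => dslope h ξ)^[N] g) ξ x
    rw [smul_eq_mul] at h
    rw [Finset.sum_range_succ, Function.iterate_succ_apply', pow_succ, mul_assoc, h]
    nth_rewrite 1 [ih]
    ring

end Taylor

/-! ### Linearity of rates and passage to the maximum norm. -/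

section RateArithmetic

open Set Polynomial

theorem chebDiffError_add {f g : ℝ → ℝ} {m : ℕ} (hf : ContDiffOn ℝ m f (Icc (-1) 1))
    (hg : ContDiffOn ℝ m g (Icc (-1) 1)) (n : ℕ) {x : ℝ} (hx : x ∈ Icc (-1 : ℝ) 1) :
    chebDiffError (f + g) m n x = chebDiffError f m n x + chebDiffError g m n x := by
  rw [chebDiffError, chebDiffError, chebDiffError, chebInterpolant_add, iterate_map_add, eval_add,
    iteratedDerivWithin_add hx (uniqueDiffOn_Icc (by norm_num)) (hf x hx) (hg x hx)]
  ring

theorem chebDiffError_const_smul {f : ℝ → ℝ} {m : ℕ} (hf : ContDiffOn ℝ m f (Icc (-1) 1))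
    (c : ℝ) (n : ℕ) {x : ℝ} (hx : x ∈ Icc (-1 : ℝ) 1) :
    chebDiffError (c • f) m n x = c * chebDiffError f m n x := by
  rw [chebDiffError, chebDiffError, chebInterpolant_const_smul, iterate_derivative_smul, eval_smul,
    iteratedDerivWithin_const_smul hx (uniqueDiffOn_Icc (by norm_num)) c (hf x hx), smul_eq_mul,
    smul_eq_mul]
  ring

theorem HasInterpRate.add {f g : ℝ → ℝ} {m : ℕ} {e : ℝ} (hf : HasInterpRate f m e)
    (hg : HasInterpRate g m e) (hfm : ContDiffOn ℝ m f (Icc (-1) 1))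
    (hgm : ContDiffOn ℝ m g (Icc (-1) 1)) : HasInterpRate (f + g) m e := by
  obtain ⟨C, hC⟩ := hf
  obtain ⟨D, hD⟩ := hg
  refine ⟨C + D, ?_⟩
  filter_upwards [hC, hD] with n h1 h2 x hx
  rw [chebDiffError_add hfm hgm n (Ioo_subset_Icc_self hx), add_mul]
  exact (abs_add_le _ _).trans (add_le_add (h1 x hx) (h2 x hx))

theorem HasInterpRate.const_smul {f : ℝ → ℝ} {m : ℕ} {e : ℝ} (hf : HasInterpRate f m e)
    (hfm : ContDiffOn ℝ m f (Icc (-1) 1)) (c : ℝ) : HasInterpRate (c • f) m e := by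
  obtain ⟨C, hC⟩ := hf
  refine ⟨|c| * C, ?_⟩
  filter_upwards [hC] with n h1 x hx
  rw [chebDiffError_const_smul hfm c n (Ioo_subset_Icc_self hx), abs_mul, mul_assoc]
  exact mul_le_mul_of_nonneg_left (h1 x hx) (abs_nonneg c)

theorem HasInterpRate.mono {f : ℝ → ℝ} {m : ℕ} {e e' : ℝ} (hf : HasInterpRate f m e)
    (he : e ≤ e') : HasInterpRate f m e' := by
  obtain ⟨C, hC⟩ := hf
  refine ⟨|C|, ?_⟩
  filter_upwards [hC, eventually_ge_atTop 1] with n h1 hn x hx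
  have hn1 : (1 : ℝ) ≤ n := by exact_mod_cast hn
  refine (h1 x hx).trans ?_
  gcongr
  exact le_abs_self C

theorem HasInterpRate.add_linearCombination {r : ℝ → ℝ} {h : ℕ → ℝ → ℝ} {m : ℕ} {e : ℝ}
    (hr : HasInterpRate r m e) (hrm : ContDiffOn ℝ m r (Icc (-1) 1))
    (hh : ∀ j, HasInterpRate (h j) m e) (hhm : ∀ j, ContDiff ℝ m (h j)) (c : ℕ → ℝ) (N : ℕ) :
    ContDiffOn ℝ m (fun x => (∑ j ∈ Finset.range N, c j * h j x) + r x) (Icc (-1) 1) ∧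
      HasInterpRate (fun x => (∑ j ∈ Finset.range N, c j * h j x) + r x) m e := by
  induction N with
  | zero => simpa using ⟨hrm, hr⟩
  | succ N ih =>
    have hs : ContDiffOn ℝ m (c N • h N) (Icc (-1) 1) := ((hhm N).const_smul (c N)).contDiffOn
    have he : (fun x => (∑ j ∈ Finset.range (N + 1), c j * h j x) + r x) =
        (fun x => (∑ j ∈ Finset.range N, c j * h j x) + r x) + c N • h N := by
      funext x
      simp only [Finset.sum_range_succ, Pi.add_apply, Pi.smul_apply, smul_eq_mul]
      ring
    rw [he]
    exact ⟨ih.1.add hs, ih.2.add ((hh N).const_smul (hhm N).contDiffOn (c N)) ih.1 hs⟩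

theorem HasInterpRate.isBigO_maxNorm {f : ℝ → ℝ} {m : ℕ} {e : ℝ} (hf : HasInterpRate f m e)
    (hfm : ContDiffOn ℝ m f (Icc (-1) 1)) :
    (fun n : ℕ => maxNorm (chebDiffError f m n)) =O[atTop] fun n : ℕ => (n : ℝ) ^ e := by
  obtain ⟨C, hC⟩ := hf
  refine IsBigO.of_bound C ?_
  filter_upwards [hC] with n hn
  have hc : ContinuousOn (fun x => |chebDiffError f m n x|) (Icc (-1) 1) :=
    ((hfm.continuousOn_iteratedDerivWithin le_rfl (uniqueDiffOn_Icc (by norm_num))).sub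
      (Polynomial.continuous _).continuousOn).abs
  -- Bounds on the open interval extend to ±1 by continuity of the error.
  have hb : ∀ x ∈ Icc (-1 : ℝ) 1, |chebDiffError f m n x| ≤ C * (n : ℝ) ^ e := by
    intro x hx
    rw [← closure_Ioo (by norm_num : (-1 : ℝ) ≠ 1)] at hx hc
    exact le_on_closure hn hc continuousOn_const hx
  have hne : ((fun x => |chebDiffError f m n x|) '' Icc (-1 : ℝ) 1).Nonempty :=
    ⟨_, 0, by norm_num, rfl⟩
  have h0 : 0 ≤ maxNorm (chebDiffError f m n) := by
    refine Real.sSup_nonneg ?_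
    rintro _ ⟨x, _, rfl⟩
    exact abs_nonneg _
  rw [Real.norm_of_nonneg h0, Real.norm_of_nonneg (by positivity)]
  refine csSup_le hne ?_
  rintro _ ⟨x, hx, rfl⟩
  exact hb x hx

/-- The rate for the model function follows from the rates of the pure powers. -/
theorem hasInterpRate_modelFun {ξ σ : ℝ} {g : ℝ → ℝ} {m : ℕ} {e : ℝ}
    (hg : AnalyticOnNhd ℝ g (Icc (-1 : ℝ) 1)) (hξ : ξ ∈ Icc (-1 : ℝ) 1) (hσ : 0 < σ)
    (hm : (m : ℝ) < σ) (hpow : ∀ j : ℕ, HasInterpRate (fun x => |x - ξ| ^ σ * (x - ξ) ^ j) m e) :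
    ContDiffOn ℝ m (modelFun ξ σ g) (Icc (-1 : ℝ) 1) ∧ HasInterpRate (modelFun ξ σ g) m e := by
  obtain ⟨K, hK⟩ := exists_nat_ge (-e)
  -- N is even, so (x - ξ)^N = |x - ξ|^N merges with |x - ξ|^σ into a C^N function. It also exceeds
  -- the 2m + K + 2 needed for the rate n^(-K) ≤ n^e, or equals it when K = 0.
  set N : ℕ := 2 * (m + K + 1) with hN
  obtain ⟨c, G, hG, hgx⟩ := exists_taylor_analyticOnNhd hg hξ N
  have hr : ∀ x ∈ Icc (-1 : ℝ) 1, ContDiffAt ℝ N (fun x => |x - ξ| ^ (σ + N) * G x) x :=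
    fun x hx => (contDiff_abs_sub_rpow (by linarith) ξ).contDiffAt.mul (hG x hx).contDiffAt
  have hrate := (hasInterpRate_of_contDiffAt (m := m) (K := K) (by omega) hr).mono
    (by linarith : -(K : ℝ) ≤ e)
  have hrm : ContDiffOn ℝ m (fun x => |x - ξ| ^ (σ + N) * G x) (Icc (-1) 1) := fun x hx =>
    ((hr x hx).of_le (by exact_mod_cast (by omega : m ≤ N))).contDiffWithinAt
  have h := hrate.add_linearCombination hrm hpow (fun j => contDiff_abs_rpow_mul_pow hm ξ j) c N
  convert! h using 2 <;>
  · funext x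
    rw [modelFun, hgx x, mul_add, Finset.mul_sum, Real.rpow_add_of_nonneg (abs_nonneg _) hσ.le
      (Nat.cast_nonneg N), Real.rpow_natCast, (show Even N from ⟨m + K + 1, by omega⟩).pow_abs]
    congr 1
    · exact Finset.sum_congr rfl fun j _ => by ring
    · ring

end RateArithmetic

theorem mainTheorem5 (ξ σ : ℝ) (g : ℝ → ℝ) (m : ℕ)
    (hg : AnalyticOnNhd ℝ g (Set.Icc (-1 : ℝ) 1)) (hσ : 0 < σ) :
    (ξ ∈ Set.Ioo (-1 : ℝ) 1 → (∀ k : ℤ, σ ≠ 2 * (k : ℝ)) → (m : ℝ) < min σ (1 + σ / 2) →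
      ContDiffOn ℝ m (modelFun ξ σ g) (Set.Icc (-1 : ℝ) 1) ∧
      (fun n : ℕ => maxNorm (chebDiffError (modelFun ξ σ g) m n)) =O[atTop]
        (fun n : ℕ => (n : ℝ) ^ (max (m : ℝ) (2 * (m : ℝ) - 2) - σ))) ∧
    (ξ = -1 ∨ ξ = 1 → (∀ k : ℤ, σ ≠ (k : ℝ)) → (m : ℝ) < σ →
      ContDiffOn ℝ m (modelFun ξ σ g) (Set.Icc (-1 : ℝ) 1) ∧
      (fun n : ℕ => maxNorm (chebDiffError (modelFun ξ σ g) m n)) =O[atTop]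
        (fun n : ℕ => (n : ℝ) ^ (max (2 * (m : ℝ)) ((m : ℝ) - 1) - 2 * σ))) := by
  constructor
  · intro hξ hσ2 hm
    have hmσ := hm.trans_le (min_le_left _ _)
    obtain ⟨h1, h2⟩ := hasInterpRate_modelFun hg (Set.Ioo_subset_Icc_self hξ) hσ hmσ
      fun j => hasInterpRate_interior_power (abs_lt.2 hξ) hσ hσ2 hmσ j
    exact ⟨h1, h2.isBigO_maxNorm h1⟩
  · intro hξ hσ2 hm
    have hξ1 : ξ ∈ Set.Icc (-1 : ℝ) 1 := by
      rcases hξ with rfl | rfl <;> norm_num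
    obtain ⟨h1, h2⟩ := hasInterpRate_modelFun hg hξ1 hσ hm
      fun j => hasInterpRate_endpoint_power hξ hσ hσ2 hm j
    have hmax : max (2 * (m : ℝ)) ((m : ℝ) - 1) = 2 * m :=
      max_eq_left (by linarith [Nat.cast_nonneg (α := ℝ) m])
    rw [hmax]
    exact ⟨h1, h2.isBigO_maxNorm h1⟩
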